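/- Let $d\ge 1$ and $k\ge 1$. All polynomials are in $x=(x_1,\dots,x_d)$ with complex coefficients, and the zero polynomial counts as homogeneous of every degree. For polynomials $f,g$ put $$\langle f,g\rangle_{L^2(\mathbb S^{d-1})}=\int_{\mathbb S^{d-1}}f(\theta)\,\overline{g(\theta)}\,d\theta ,$$ where $d\theta$ is the surface measure of the unit sphere $\mathbb S^{d-1}\subset\mathbb R^d$. The order of an entire function $f:\mathbb C^d\to\mathbb C$ is $$\rho(f)=\limsup_{r\to\infty}\frac{\log\log M(f,r)}{\log r}\in[0,\infty],\qquad M(f,r)=\sup\{|f(\zeta\theta)|:\zeta\in\mathbb C,\ |\zeta|=r,\ \theta\in\mathbb S^{d-1}\},$$ and constant functions have order $0$. Let $\Delta=\partial^2/\partial z_1^2+\dots+\partial^2/\partial z_d^2$. Let $P_{2k}$ be a homogeneous polynomial of degree $2k$ such that, for some $C>0$, $D>0$ and $\alpha\ge 0$, $$\langle P_{2k}f_m,f_m\rangle_{L^2(\mathbb S^{d-1})}\ \ge\ \frac{1}{C(m+D)^{\alpha}}\,\langle f_m,f_m\rangle_{L^2(\mathbb S^{d-1})}$$ (in particular the left side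 is real) for every integer $m\ge 0$ and every homogeneous polynomial $f_m$ of degree $m$. Let $\beta$ be an integer with $0\le\beta<2k$, and for $j=0,\dots,\beta$ let $P_j$ be a homogeneous polynomial of degree $j$. Then for every entire function $f:\mathbb C^d\to\mathbb C$ of order $\rho<(2k-\beta)/\alpha$, where $(2k-\beta)/\alpha$ is read as $\infty$ if $\alpha=0$, there exist entire functions $q,r:\mathbb C^d\to\mathbb C$ of order $\le\rho$ such that $$f=(P_{2k}-P_\beta-\dots-P_0)\,q+r\qquad\text{and}\qquad \Delta^k r=0 .$$ -/

import Mathlib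

open MeasureTheory Filter
open scoped ENNReal ComplexOrder

namespace Fischer

/-- The inclusion `ℝ^d ⊆ ℂ^d`. -/
def toComplex {d : ℕ} (x : EuclideanSpace ℝ (Fin d)) : Fin d → ℂ :=
  fun i => ((x i : ℝ) : ℂ)

/-- `⟨f, g⟩ = ∫_{S^{d-1}} f(θ) * conj (g(θ)) dθ` for polynomials with complex coefficients, where
`dθ` is the (unnormalised) surface measure of the Euclidean unit sphere of `ℝ^d`. -/
noncomputable def sphereInner {d : ℕ} (f g : MvPolynomial (Fin d) ℂ) : ℂ :=
  ∫ θ : Metric.sphere (0 : EuclideanSpace ℝ (Fin d)) 1,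
    MvPolynomial.eval (toComplex θ.1) f * starRingEnd ℂ (MvPolynomial.eval (toComplex θ.1) g)
    ∂((volume : Measure (EuclideanSpace ℝ (Fin d))).toSphere)

/-- `M(f, r) = sup { |f(ζ θ)| : ζ ∈ ℂ, |ζ| = r, θ ∈ S^{d-1} }`. -/
noncomputable def maxModulus {d : ℕ} (f : (Fin d → ℂ) → ℂ) (r : ℝ) : ℝ :=
  sSup {y : ℝ | ∃ (ζ : ℂ) (θ : EuclideanSpace ℝ (Fin d)),
    ‖ζ‖ = r ∧ ‖θ‖ = 1 ∧ y = ‖f (ζ • toComplex θ)‖}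

/-- The order `limsup_{r → ∞} log (log M(f, r)) / log r ∈ [0, ∞]` of an entire function `f`.
For nonconstant entire `f` one has `M(f, r) → ∞`, so both logarithms are eventually positive and
`ENNReal.ofReal` truncates nothing; constants get the order `0`. -/
noncomputable def order {d : ℕ} (f : (Fin d → ℂ) → ℂ) : ℝ≥0∞ :=
  limsup (fun r : ℝ => ENNReal.ofReal (Real.log (Real.log (maxModulus f r)) / Real.log r)) atTop

/-- The partial derivative `∂f/∂z_j` of a function on `ℂ^d`. -/
noncomputable def partialDeriv {d : ℕ} (j : Fin d) (f : (Fin d → ℂ) → ℂ) : (Fin d → ℂ) → ℂ :=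
  fun z => lineDeriv ℂ f z (Pi.single j 1)

/-- The Laplace operator `Δ = ∂²/∂z_1² + ⋯ + ∂²/∂z_d²` on functions on `ℂ^d`. -/
noncomputable def laplacian {d : ℕ} (f : (Fin d → ℂ) → ℂ) : (Fin d → ℂ) → ℂ :=
  fun z => ∑ j : Fin d, partialDeriv j (partialDeriv j f) z

end Fischer

/-! The division is carried out degree by degree on the Taylor expansion of `f`, with bounds sharp
enough to sum the quotients.

Homogeneous division. On the sphere, a `k`-harmonic homogeneous polynomial of degree `n + 2k` is
orthogonal to all homogeneous polynomials of degree `n`. So if `g - P q` is `k`-harmonic, then `⟨P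
q, q⟩ = ⟨g, q⟩`, and the lower bound on `P` together with Cauchy-Schwarz gives `‖q‖ ≤ C (n + D)^α
‖g‖`. For `g = 0` this says that `q ↦ Δ^k (P q)` is injective on a finite-dimensional space, hence
bijective, so `q` exists (`exists_fischer_decomposition`).

Lower order terms. Dividing by `P` alone leaves the products `P_j q`, whose degree is lower by at
least `2k - β`; they are divided again, recursively. Each round costs a factor of size `m^α` and
gains `2k - β` degrees, so the total loss in degree `m` is about `m^(α m / (2k - β))`
(`exists_quotient`).

Summation. Cauchy's inequality for order less than `σ` bounds the Taylor component of degree `m` by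
about `e^m m^(-m/σ)`. This beats the loss exactly when `α / (2k - β) < 1 / σ`, and the resulting
series is entire and grows no faster than `exp (R^τ)` for each `τ > σ`
(`locallySummable_and_hasGrowth`).

Bounds in `L²` of the real sphere become pointwise bounds on `ℂ^d` with only exponential loss in the
degree (`norm_eval_le_sphereNorm`). Both this and the orthogonality come from integration by parts
against the Gaussian, which polar coordinates relate to the sphere. -/

namespace Fischer

open MvPolynomial

variable {d : ℕ}

/-! ### Algebra of the Laplacian on polynomials. -/

/-- The polynomial whose coefficients are the complex conjugates of those of `p`. -/
noncomputable abbrev conjPoly (p : MvPolynomial (Fin d) ℂ) : MvPolynomial (Fin d) ℂ :=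
  MvPolynomial.map (starRingEnd ℂ) p

/-- The Laplace operator on polynomials. -/
noncomputable def polyLaplacian (d : ℕ) : Module.End ℂ (MvPolynomial (Fin d) ℂ) :=
  ∑ i : Fin d, (pderiv i).toLinearMap ∘ₗ (pderiv i).toLinearMap

lemma polyLaplacian_apply (p : MvPolynomial (Fin d) ℂ) :
    polyLaplacian d p = ∑ i, pderiv i (pderiv i p) := by
  simp [polyLaplacian, LinearMap.sum_apply]

lemma pderiv_comm (i j : Fin d) (p : MvPolynomial (Fin d) ℂ) :
    pderiv i (pderiv j p) = pderiv j (pderiv i p) := by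
  classical
  have h : ⁅(pderiv i : Derivation ℂ (MvPolynomial (Fin d) ℂ) (MvPolynomial (Fin d) ℂ)),
      (pderiv j : Derivation ℂ (MvPolynomial (Fin d) ℂ) (MvPolynomial (Fin d) ℂ))⁆ = 0 := by
    apply MvPolynomial.derivation_ext
    intro k
    simp [Derivation.commutator_apply, pderiv_X, Pi.single_apply]
    split_ifs <;> simp
  have := congrArg (fun D => D p) h
  simpa [Derivation.commutator_apply, sub_eq_zero] using this

lemma polyLaplacian_pderiv (i : Fin d) (p : MvPolynomial (Fin d) ℂ) :
    polyLaplacian d (pderiv i p) = pderiv i (polyLaplacian d p) := by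
  simp only [polyLaplacian_apply, map_sum]
  refine Finset.sum_congr rfl fun j _ => ?_
  rw [pderiv_comm j i p, pderiv_comm j i]

lemma polyLaplacian_pow_pderiv (k : ℕ) (i : Fin d) (p : MvPolynomial (Fin d) ℂ) :
    (polyLaplacian d ^ k) (pderiv i p) = pderiv i ((polyLaplacian d ^ k) p) := by
  induction k generalizing p with
  | zero => simp
  | succ k ih => simp only [pow_succ, Module.End.mul_apply, polyLaplacian_pderiv, ih]

lemma polyLaplacian_mul (p q : MvPolynomial (Fin d) ℂ) :
    polyLaplacian d (p * q) = polyLaplacian d p * q + 2 * ∑ i, pderiv i p * pderiv i q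
      + p * polyLaplacian d q := by
  simp only [polyLaplacian_apply, pderiv_mul, map_add, Finset.sum_add_distrib, Finset.sum_mul,
    Finset.mul_sum, two_mul]
  ring

lemma polyLaplacian_conjPoly (p : MvPolynomial (Fin d) ℂ) :
    polyLaplacian d (conjPoly p) = conjPoly (polyLaplacian d p) := by
  simp [polyLaplacian_apply, pderiv_map]

lemma isHomogeneous_polyLaplacian {p : MvPolynomial (Fin d) ℂ} {n : ℕ} (hp : p.IsHomogeneous n) :
    (polyLaplacian d p).IsHomogeneous (n - 2) := by
  rw [polyLaplacian_apply]
  refine IsHomogeneous.sum _ _ _ fun i _ => ?_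
  have := (hp.pderiv (i := i)).pderiv (i := i)
  rwa [Nat.sub_sub] at this

lemma isHomogeneous_polyLaplacian_pow {p : MvPolynomial (Fin d) ℂ} {n : ℕ}
    (hp : p.IsHomogeneous n) (k : ℕ) :
    ((polyLaplacian d ^ k) p).IsHomogeneous (n - 2 * k) := by
  induction k with
  | zero => simpa
  | succ k ih =>
    rw [pow_succ', Module.End.mul_apply]
    have := isHomogeneous_polyLaplacian ih
    rwa [Nat.sub_sub] at this

lemma pderiv_eq_zero_of_isHomogeneous_zero {p : MvPolynomial (Fin d) ℂ}
    (hp : p.IsHomogeneous 0) (i : Fin d) : pderiv i p = 0 := by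
  rw [← totalDegree_zero_iff_isHomogeneous, totalDegree_eq_zero_iff_eq_C] at hp
  rw [hp, pderiv_C]

lemma polyLaplacian_eq_zero {p : MvPolynomial (Fin d) ℂ} {n : ℕ}
    (hp : p.IsHomogeneous n) (hn : n < 2) : polyLaplacian d p = 0 := by
  rw [polyLaplacian_apply]
  refine Finset.sum_eq_zero fun i _ => pderiv_eq_zero_of_isHomogeneous_zero ?_ i
  have := hp.pderiv (i := i)
  rwa [show n - 1 = 0 by omega] at this

lemma polyLaplacian_pow_eq_zero {p : MvPolynomial (Fin d) ℂ} {n k : ℕ}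
    (hp : p.IsHomogeneous n) (hn : n < 2 * k) : (polyLaplacian d ^ k) p = 0 := by
  obtain ⟨k, rfl⟩ : ∃ j, k = j + 1 := ⟨k - 1, by omega⟩
  by_cases h : n < 2 * k
  · rw [pow_succ', Module.End.mul_apply, polyLaplacian_pow_eq_zero hp h, map_zero]
  · rw [pow_succ', Module.End.mul_apply]
    exact polyLaplacian_eq_zero (isHomogeneous_polyLaplacian_pow hp k) (by omega)

/-! ### Consequences of Gaussian integration by parts. -/

/-- A positive functional on polynomials which obeys the integration by parts rule of the
Gaussian measure. -/
structure IsGaussian (E : MvPolynomial (Fin d) ℂ →ₗ[ℂ] ℂ) : Prop where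
  X_mul : ∀ i p, E (X i * p) = E (pderiv i p)
  nonneg : ∀ p, 0 ≤ E (p * conjPoly p)

namespace IsGaussian

variable {E : MvPolynomial (Fin d) ℂ →ₗ[ℂ] ℂ}

/-- Euler's identity `n p = ∑ X_i ∂_i p`, followed by integration by parts of each `X_i`. -/
lemma euler (hE : IsGaussian E) {p : MvPolynomial (Fin d) ℂ} {n : ℕ} (hp : p.IsHomogeneous n)
    (q : MvPolynomial (Fin d) ℂ) :
    n * E (p * q) = E (polyLaplacian d p * q) + ∑ i, E (pderiv i p * pderiv i q) := by
  have h : (n : ℂ) * E (p * q) = E ((n • p) * q) := by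
    rw [smul_mul_assoc, map_nsmul, nsmul_eq_mul]
  rw [h, ← hp.sum_X_mul_pderiv, Finset.sum_mul, map_sum, polyLaplacian_apply, Finset.sum_mul,
    map_sum, ← Finset.sum_add_distrib]
  refine Finset.sum_congr rfl fun i _ => ?_
  rw [mul_assoc, hE.X_mul, pderiv_mul, map_add]

lemma apply_polyLaplacian (hE : IsGaussian E) {p : MvPolynomial (Fin d) ℂ} {n : ℕ}
    (hp : p.IsHomogeneous n) : E (polyLaplacian d p) = n * E p := by
  have := hE.euler hp 1
  simpa [eq_comm] using this

/-- Each application of the Laplacian multiplies the value of `E` by the current degree, which is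
nonzero as long as `2 * k ≤ n`. -/
lemma eq_zero_of_polyLaplacian_pow (hE : IsGaussian E) {p : MvPolynomial (Fin d) ℂ} {n k : ℕ}
    (hp : p.IsHomogeneous n) (hn : 2 * k ≤ n) (h : (polyLaplacian d ^ k) p = 0) : E p = 0 := by
  induction k generalizing p n with
  | zero => simp_all
  | succ k ih =>
    have h1 := ih (isHomogeneous_polyLaplacian hp) (by omega)
      (by rwa [pow_succ, Module.End.mul_apply] at h)
    rw [hE.apply_polyLaplacian hp] at h1
    have : (n : ℂ) ≠ 0 := by exact_mod_cast (by omega : n ≠ 0)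
    simpa [this] using h1

/-- A homogeneous `k`-harmonic polynomial is orthogonal to the homogeneous polynomials whose
degree is smaller by at least `2 * k`. -/
lemma mul_eq_zero_of_polyLaplacian_pow (hE : IsGaussian E) {k : ℕ} (m : ℕ) :
    ∀ {n : ℕ} {h q : MvPolynomial (Fin d) ℂ}, h.IsHomogeneous n → m + 2 * k ≤ n →
      (polyLaplacian d ^ k) h = 0 → q.IsHomogeneous m → E (h * q) = 0 := by
  induction m using Nat.strong_induction_on with
  | _ m ih =>
    intro n h q hh hn hk hq
    rcases Nat.eq_zero_or_pos m with rfl | hm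
    · rw [← totalDegree_zero_iff_isHomogeneous, totalDegree_eq_zero_iff_eq_C] at hq
      rw [hq, mul_comm, C_mul', map_smul, hE.eq_zero_of_polyLaplacian_pow hh (by omega) hk,
        smul_zero]
    -- Euler's rule is applied to the factor of lower degree: in `Δq * h` and `∂_i q * ∂_i h` the
    -- degree gap is still at least `2 * k`, and the degree of the first factor has dropped.
    · have key := hE.euler hq h
      have h1 : E (polyLaplacian d q * h) = 0 := by
        by_cases h2 : m < 2
        · simp [polyLaplacian_eq_zero hq h2]
        · rw [mul_comm]
          exact ih (m - 2) (by omega) hh (by omega) hk (isHomogeneous_polyLaplacian hq)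
      have h2 : ∀ i, E (pderiv i q * pderiv i h) = 0 := fun i => by
        rw [mul_comm]
        exact ih (m - 1) (by omega) hh.pderiv (by omega)
          (by rw [polyLaplacian_pow_pderiv, hk, map_zero]) hq.pderiv
      have hm' : (m : ℂ) ≠ 0 := by exact_mod_cast hm.ne'
      rw [h1, Finset.sum_eq_zero fun i _ => h2 i, add_zero, mul_comm q] at key
      simpa [hm'] using key

/-- Up to a positive factor the value equals `E` of the Laplacian of the product, and the product
rule yields three terms of the same shape: for `Δp` and the `∂_i p`, of lower degree, and for `p`
with `j + 1`. The outer induction is on the degree; the fuel `s` makes `j` increase until `2 * j`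
exceeds the degree, where the term vanishes. -/
lemma polyLaplacian_pow_mul_conj_nonneg (hE : IsGaussian E) (l : ℕ) :
    ∀ (s j : ℕ) (p : MvPolynomial (Fin d) ℂ), p.IsHomogeneous l → l + 1 ≤ s + 2 * j →
      0 ≤ E (conjPoly p * (polyLaplacian d ^ j) p) := by
  induction l using Nat.strong_induction_on with
  | _ l ihl =>
    intro s
    induction s using Nat.strong_induction_on with
    | _ s ihs =>
      intro j p hp hs
      by_cases hl : l < 2 * j
      · simp [polyLaplacian_pow_eq_zero hp hl]
      rcases Nat.eq_zero_or_pos j with rfl | hj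
      · simpa [mul_comm] using hE.nonneg p
      have hhom : (conjPoly p * (polyLaplacian d ^ j) p).IsHomogeneous (l + (l - 2 * j)) :=
        (hp.map _).mul (isHomogeneous_polyLaplacian_pow hp j)
      have key := hE.apply_polyLaplacian hhom
      obtain ⟨i, rfl⟩ : ∃ i, j = i + 1 := ⟨j - 1, by omega⟩
      have h1 : 0 ≤ E (conjPoly (polyLaplacian d p) * (polyLaplacian d ^ i) (polyLaplacian d p)) :=
        ihl (l - 2) (by omega) (l + 1) i _ (isHomogeneous_polyLaplacian hp) (by omega)
      have h2 : ∀ a, 0 ≤ E (conjPoly (pderiv a p) * (polyLaplacian d ^ (i + 1)) (pderiv a p)) :=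
        fun a => ihl (l - 1) (by omega) (l + 1) _ _ hp.pderiv (by omega)
      have h3 : 0 ≤ E (conjPoly p * (polyLaplacian d ^ (i + 2)) p) :=
        ihs (s - 1) (by omega) (i + 2) p hp (by omega)
      have h4 : 0 ≤ E (polyLaplacian d (conjPoly p * (polyLaplacian d ^ (i + 1)) p)) := by
        rw [polyLaplacian_mul, map_add, map_add, polyLaplacian_conjPoly]
        refine add_nonneg (add_nonneg ?_ ?_) ?_
        · simpa [pow_succ, Module.End.mul_apply] using h1
        · rw [two_mul, map_add, map_sum]
          refine add_nonneg ?_ ?_ <;>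
          · refine Finset.sum_nonneg fun a _ => ?_
            rw [pderiv_map, ← polyLaplacian_pow_pderiv]
            exact h2 a
        · simpa [pow_succ', Module.End.mul_apply] using h3
      rw [key] at h4
      have hne : ((l + (l - 2 * (i + 1)) : ℕ) : ℂ) ≠ 0 := by
        exact_mod_cast (by omega : l + (l - 2 * (i + 1)) ≠ 0)
      have hinv : (0 : ℂ) ≤ ((l + (l - 2 * (i + 1)) : ℕ) : ℂ)⁻¹ := by
        rw [← Complex.ofReal_natCast, ← Complex.ofReal_inv, Complex.zero_le_real]
        positivity
      have h5 := mul_nonneg hinv h4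
      rwa [inv_mul_cancel_left₀ hne] at h5

/-- In Euler's rule for `p` and its conjugate, the term with `Δp` is nonnegative and can be dropped.
-/
lemma sum_pderiv_le (hE : IsGaussian E) {p : MvPolynomial (Fin d) ℂ} {l : ℕ}
    (hp : p.IsHomogeneous l) :
    ∑ i, E (pderiv i p * conjPoly (pderiv i p)) ≤ l * E (p * conjPoly p) := by
  have h := hE.polyLaplacian_pow_mul_conj_nonneg l (l + 1) 1 p hp (by omega)
  rw [hE.euler hp]
  simp only [pderiv_map]
  rw [pow_one, mul_comm] at h
  exact le_add_of_nonneg_left h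

end IsGaussian

/-! ### The Gaussian integral on polynomials. -/

lemma hasFDerivAt_eval (p : MvPolynomial (Fin d) ℂ) (z : Fin d → ℂ) :
    HasFDerivAt (fun z : Fin d → ℂ => eval z p)
      (∑ i, eval z (pderiv i p) • (ContinuousLinearMap.proj i : (Fin d → ℂ) →L[ℂ] ℂ)) z := by
  classical
  induction p using MvPolynomial.induction_on with
  | C a =>
    simp only [eval_C]
    refine (hasFDerivAt_const (𝕜 := ℂ) a z).congr_fderiv ?_
    ext v
    simp
  | add p q hp hq =>
    simp only [map_add]
    refine (hp.add hq).congr_fderiv ?_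
    ext v
    simp [add_mul, Finset.sum_add_distrib]
  | mul_X p j hp =>
    have h1 : HasFDerivAt (fun z : Fin d → ℂ => z j)
      (ContinuousLinearMap.proj j : (Fin d → ℂ) →L[ℂ] ℂ) z :=
      hasFDerivAt_apply j z
    simp only [map_mul, eval_X]
    refine (hp.mul h1).congr_fderiv ?_
    ext v
    simp only [pderiv_mul, pderiv_X, map_add, map_mul, eval_X, add_mul, Finset.sum_add_distrib,
      add_apply, sum_apply, smul_apply, ContinuousLinearMap.proj_apply, smul_eq_mul,
      Pi.single_apply, apply_ite (eval z), map_zero, mul_ite, mul_one, mul_zero, ite_mul,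
      zero_mul, Finset.sum_ite_eq, Finset.mem_univ, if_true, Finset.mul_sum]
    rw [add_comm]
    congr 1
    refine Finset.sum_congr rfl fun i _ => by ring

lemma differentiable_eval (p : MvPolynomial (Fin d) ℂ) :
    Differentiable ℂ (fun z : Fin d → ℂ => eval z p) :=
  fun z => (hasFDerivAt_eval p z).differentiableAt

lemma continuous_toComplex : Continuous (toComplex (d := d)) := by
  unfold toComplex
  fun_prop

lemma toComplex_smul (r : ℝ) (x : EuclideanSpace ℝ (Fin d)) :
    toComplex (r • x) = (r : ℂ) • toComplex x := by
  ext i; simp [toComplex]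

lemma eval_smul_of_isHomogeneous {p : MvPolynomial (Fin d) ℂ} {n : ℕ} (hp : p.IsHomogeneous n)
    (c : ℂ) (z : Fin d → ℂ) : eval (c • z) p = c ^ n * eval z p := by
  rw [eval_eq, eval_eq, Finset.mul_sum]
  refine Finset.sum_congr rfl fun s hs => ?_
  have := hp.degree_eq_sum_deg_support hs
  simp only [Pi.smul_apply, smul_eq_mul, mul_pow, Finset.prod_mul_distrib,
    Finset.prod_pow_eq_pow_sum]
  rw [← this]
  ring

lemma eval_toComplex_conjPoly (p : MvPolynomial (Fin d) ℂ) (x : EuclideanSpace ℝ (Fin d)) :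
    eval (toComplex x) (conjPoly p) = starRingEnd ℂ (eval (toComplex x) p) := by
  have h : toComplex x = fun i => starRingEnd ℂ (toComplex x i) := by
    ext i; simp [toComplex]
  conv_lhs => rw [h]
  rw [eval_map]
  exact (eval₂_comp_left (starRingEnd ℂ) (RingHom.id ℂ) (toComplex x) p).symm

lemma continuous_eval_toComplex (p : MvPolynomial (Fin d) ℂ) :
    Continuous fun x : EuclideanSpace ℝ (Fin d) => eval (toComplex x) p :=
  (MvPolynomial.continuous_eval p).comp continuous_toComplex

/-- Serves both for integrability against the Gaussian and as a supremum bound on the unit sphere.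
-/
lemma norm_eval_toComplex_le_exp (p : MvPolynomial (Fin d) ℂ) {ε : ℝ} (hε : 0 < ε) :
    ∃ C : ℝ, ∀ x : EuclideanSpace ℝ (Fin d),
      ‖eval (toComplex x) p‖ ≤ C * Real.exp (ε * ‖x‖ ^ 2) := by
  induction p using MvPolynomial.induction_on generalizing ε with
  | C a =>
    refine ⟨‖a‖, fun x => ?_⟩
    rw [eval_C]
    exact le_mul_of_one_le_right (norm_nonneg _) (Real.one_le_exp (by positivity))
  | add p q hp hq =>
    obtain ⟨A, hA⟩ := hp hε
    obtain ⟨B, hB⟩ := hq hε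
    refine ⟨A + B, fun x => ?_⟩
    rw [map_add, add_mul]
    exact (norm_add_le _ _).trans (add_le_add (hA x) (hB x))
  | mul_X p i hp =>
    obtain ⟨A, hA⟩ := hp (half_pos hε)
    refine ⟨A * (1 + 2 / ε), fun x => ?_⟩
    have hx : ‖eval (toComplex x) (X i : MvPolynomial (Fin d) ℂ)‖ ≤ ‖x‖ := by
      simpa [toComplex] using PiLp.norm_apply_le x i
    have h1 : ‖x‖ ≤ (1 + 2 / ε) * Real.exp (ε / 2 * ‖x‖ ^ 2) := by
      have h2 := Real.add_one_le_exp (ε / 2 * ‖x‖ ^ 2)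
      have h3 : ‖x‖ ≤ 1 + ‖x‖ ^ 2 := by nlinarith [sq_nonneg (‖x‖ - 1), norm_nonneg x]
      have h4 : ‖x‖ ^ 2 ≤ 2 / ε * Real.exp (ε / 2 * ‖x‖ ^ 2) := by
        rw [div_mul_eq_mul_div, le_div_iff₀ hε]
        linarith
      have h5 : 1 ≤ Real.exp (ε / 2 * ‖x‖ ^ 2) := Real.one_le_exp (by positivity)
      linarith
    rw [map_mul, norm_mul]
    calc ‖eval (toComplex x) p‖ * ‖eval (toComplex x) (X i : MvPolynomial (Fin d) ℂ)‖
        ≤ (A * Real.exp (ε / 2 * ‖x‖ ^ 2)) * ((1 + 2 / ε) * Real.exp (ε / 2 * ‖x‖ ^ 2)) :=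
          mul_le_mul (hA x) (hx.trans h1) (norm_nonneg _) ((norm_nonneg _).trans (hA x))
      _ = A * (1 + 2 / ε) * (Real.exp (ε / 2 * ‖x‖ ^ 2) * Real.exp (ε / 2 * ‖x‖ ^ 2)) := by ring
      _ = A * (1 + 2 / ε) * Real.exp (ε * ‖x‖ ^ 2) := by
          rw [← Real.exp_add]; ring_nf

/-- The density `exp (-|x|² / 2)`. -/
noncomputable def gaussWeight (x : EuclideanSpace ℝ (Fin d)) : ℝ := Real.exp (-(‖x‖ ^ 2 / 2))

lemma continuous_gaussWeight : Continuous (gaussWeight (d := d)) := by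
  unfold gaussWeight
  fun_prop

lemma integrable_eval_mul_gaussWeight (p : MvPolynomial (Fin d) ℂ) :
    Integrable fun x : EuclideanSpace ℝ (Fin d) => eval (toComplex x) p * (gaussWeight x : ℂ) := by
  obtain ⟨C, hC⟩ := norm_eval_toComplex_le_exp p (ε := 1 / 4) (by norm_num)
  have h := GaussianFourier.integrable_cexp_neg_mul_sq_norm_add (V := EuclideanSpace ℝ (Fin d))
    (b := (1 / 4 : ℂ)) (by norm_num) 0 0
  refine (h.norm.const_mul C).mono' ?_ (.of_forall fun x => ?_)
  · exact ((continuous_eval_toComplex p).mul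
      (Complex.continuous_ofReal.comp continuous_gaussWeight)).aestronglyMeasurable
  · have h1 : ‖Complex.exp (-(1 / 4 : ℂ) * (‖x‖ : ℂ) ^ 2 + 0 * (inner ℝ 0 x : ℝ))‖
        = Real.exp (-(1 / 4) * ‖x‖ ^ 2) := by
      rw [Complex.norm_exp, zero_mul, add_zero,
        show (-(1 / 4 : ℂ) * (‖x‖ : ℂ) ^ 2) = ((-(1 / 4) * ‖x‖ ^ 2 : ℝ) : ℂ) by push_cast; ring,
        Complex.ofReal_re]
    rw [norm_mul]
    simp only [h1]
    calc ‖eval (toComplex x) p‖ * ‖(gaussWeight x : ℂ)‖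
        ≤ (C * Real.exp (1 / 4 * ‖x‖ ^ 2)) * Real.exp (-(‖x‖ ^ 2 / 2)) := by
          refine mul_le_mul (hC x) (le_of_eq ?_) (norm_nonneg _) ((norm_nonneg _).trans (hC x))
          rw [Complex.norm_real, gaussWeight, Real.norm_of_nonneg (Real.exp_pos _).le]
      _ = C * (Real.exp (1 / 4 * ‖x‖ ^ 2) * Real.exp (-(‖x‖ ^ 2 / 2))) := by ring
      _ = C * Real.exp (-(1 / 4) * ‖x‖ ^ 2) := by
          rw [← Real.exp_add]; ring_nf

/-- Integration of polynomials against the Gaussian weight. -/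
noncomputable def gaussFunctional (d : ℕ) : MvPolynomial (Fin d) ℂ →ₗ[ℂ] ℂ where
  toFun p := ∫ x : EuclideanSpace ℝ (Fin d), eval (toComplex x) p * (gaussWeight x : ℂ)
  map_add' p q := by
    simp only [map_add, add_mul]
    exact integral_add (integrable_eval_mul_gaussWeight p) (integrable_eval_mul_gaussWeight q)
  map_smul' c p := by
    simp only [smul_eval, mul_assoc, RingHom.id_apply, smul_eq_mul]
    exact integral_const_mul _ _

lemma toComplex_add_smul_single (x : EuclideanSpace ℝ (Fin d)) (t : ℝ) (i : Fin d) :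
    toComplex (x + t • EuclideanSpace.single i 1) = toComplex x + (t : ℂ) • Pi.single i (1 : ℂ) := by
  ext j
  by_cases h : j = i
  · subst h; simp [toComplex]
  · simp [toComplex, h]

lemma hasLineDerivAt_eval_toComplex (p : MvPolynomial (Fin d) ℂ) (i : Fin d)
    (x : EuclideanSpace ℝ (Fin d)) :
    HasLineDerivAt ℝ (fun x => eval (toComplex x) p) (eval (toComplex x) (pderiv i p)) x
      (EuclideanSpace.single i 1) := by
  unfold HasLineDerivAt
  simp only [toComplex_add_smul_single]
  have h1 : HasDerivAt (fun t : ℝ => toComplex x + (t : ℂ) • (Pi.single i 1 : Fin d → ℂ))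
      (Pi.single i 1) 0 := by
    have := ((hasDerivAt_id (0 : ℝ)).ofReal_comp.smul_const (Pi.single i 1 : Fin d → ℂ)).const_add
      (toComplex x)
    simpa using this
  have h2 := (hasFDerivAt_eval p (toComplex x)).restrictScalars ℝ
  have h3 := HasFDerivAt.comp_hasDerivAt_of_eq (0 : ℝ) h2 h1 (by simp)
  refine h3.congr_deriv ?_
  change (∑ j, eval (toComplex x) (pderiv j p) •
    (ContinuousLinearMap.proj j : (Fin d → ℂ) →L[ℂ] ℂ)) (Pi.single i 1) = _
  simp [Pi.single_apply]

lemma hasLineDerivAt_gaussWeight (i : Fin d) (x : EuclideanSpace ℝ (Fin d)) :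
    HasLineDerivAt ℝ (fun x => (gaussWeight x : ℂ)) (-(toComplex x i * (gaussWeight x : ℂ))) x
      (EuclideanSpace.single i 1) := by
  have h0 : HasFDerivAt (fun x : EuclideanSpace ℝ (Fin d) => ‖x‖ ^ 2) _ x :=
    (hasStrictFDerivAt_norm_sq x).hasFDerivAt
  have h1 := ((h0.mul_const (1 / 2 : ℝ)).neg.exp).hasLineDerivAt (EuclideanSpace.single i 1)
  have h2 : HasLineDerivAt ℝ (fun x : EuclideanSpace ℝ (Fin d) => gaussWeight x)
      (-(x i * gaussWeight x)) x (EuclideanSpace.single i 1) := by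
    have e1 : (fun x : EuclideanSpace ℝ (Fin d) => gaussWeight x) =
        fun x => Real.exp ((-fun y : EuclideanSpace ℝ (Fin d) => ‖y‖ ^ 2 * (1 / 2)) x) := by
      ext y
      simp [gaussWeight, div_eq_mul_inv]
    rw [e1]
    refine h1.congr_deriv ?_
    simp [gaussWeight, div_eq_mul_inv, EuclideanSpace.inner_single_right]
    ring
  have h3 := HasDerivAt.ofReal_comp h2
  unfold HasLineDerivAt
  simpa [toComplex] using h3

lemma isGaussian_gaussFunctional : IsGaussian (gaussFunctional d) where
  X_mul i p := by
    have key := integral_bilinear_hasLineDerivAt_right_eq_neg_left_of_integrable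
      (μ := (volume : Measure (EuclideanSpace ℝ (Fin d))))
      (f := fun x => eval (toComplex x) p) (f' := fun x => eval (toComplex x) (pderiv i p))
      (g := fun x => (gaussWeight x : ℂ)) (g' := fun x => -(toComplex x i * (gaussWeight x : ℂ)))
      (v := EuclideanSpace.single i 1) (B := ContinuousLinearMap.mul ℝ ℂ)
      (integrable_eval_mul_gaussWeight _) ?_ (integrable_eval_mul_gaussWeight _)
      (fun x _ => hasLineDerivAt_eval_toComplex p i x) (fun x _ => hasLineDerivAt_gaussWeight i x)
    · simp only [ContinuousLinearMap.mul_apply', mul_neg, integral_neg, neg_inj] at key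
      simp only [gaussFunctional, LinearMap.coe_mk, AddHom.coe_mk, map_mul, eval_X]
      rw [← key]
      refine integral_congr_ae (.of_forall fun x => ?_)
      simp only
      ring
    · refine (integrable_eval_mul_gaussWeight (X i * p)).neg.congr (.of_forall fun x => ?_)
      simp
      ring
  nonneg p := by
    have : gaussFunctional d (p * conjPoly p) =
        ((∫ x : EuclideanSpace ℝ (Fin d), ‖eval (toComplex x) p‖ ^ 2 * gaussWeight x : ℝ) : ℂ) := by
      rw [← integral_complex_ofReal]
      refine integral_congr_ae (.of_forall fun x => ?_)
      simp only [map_mul, eval_toComplex_conjPoly, Complex.mul_conj, Complex.normSq_eq_norm_sq]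
      push_cast
      ring
    rw [this, Complex.zero_le_real]
    exact integral_nonneg fun x => mul_nonneg (by positivity) (Real.exp_pos _).le

/-! ### From the Gaussian to the sphere by polar coordinates. -/

/-- The surface measure of the unit sphere of `ℝ^d`. -/
noncomputable abbrev sphereMeasure (d : ℕ) :
    Measure (Metric.sphere (0 : EuclideanSpace ℝ (Fin d)) 1) :=
  (volume : Measure (EuclideanSpace ℝ (Fin d))).toSphere

lemma integrable_sphereMeasure {F : Type*} [NormedAddCommGroup F]
    {g : Metric.sphere (0 : EuclideanSpace ℝ (Fin d)) 1 → F} (hg : Continuous g) :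
    Integrable g (sphereMeasure d) :=
  hg.integrable_of_hasCompactSupport (HasCompactSupport.of_compactSpace g)

lemma continuous_eval_sphere (p : MvPolynomial (Fin d) ℂ) :
    Continuous fun θ : Metric.sphere (0 : EuclideanSpace ℝ (Fin d)) 1 => eval (toComplex θ.1) p :=
  (continuous_eval_toComplex p).comp continuous_subtype_val

/-- Integration of polynomials over the unit sphere. -/
noncomputable def sphereFunctional (d : ℕ) : MvPolynomial (Fin d) ℂ →ₗ[ℂ] ℂ where
  toFun p := ∫ θ, eval (toComplex θ.1) p ∂(sphereMeasure d)
  map_add' p q := by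
    simp only [map_add]
    exact integral_add (integrable_sphereMeasure (continuous_eval_sphere p))
      (integrable_sphereMeasure (continuous_eval_sphere q))
  map_smul' c p := by
    simp only [smul_eval, RingHom.id_apply, smul_eq_mul]
    exact integral_const_mul _ _

lemma sphereInner_eq (p q : MvPolynomial (Fin d) ℂ) :
    sphereInner p q = sphereFunctional d (p * conjPoly q) := by
  simp only [sphereInner, sphereFunctional, LinearMap.coe_mk, AddHom.coe_mk, map_mul,
    eval_toComplex_conjPoly]

/-- The square of the norm of `p` in `L²` of the unit sphere. -/
noncomputable def sphereNormSq (p : MvPolynomial (Fin d) ℂ) : ℝ :=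
  ∫ θ, ‖eval (toComplex θ.1) p‖ ^ 2 ∂(sphereMeasure d)

lemma sphereNormSq_nonneg (p : MvPolynomial (Fin d) ℂ) : 0 ≤ sphereNormSq p :=
  integral_nonneg fun _ => by positivity

lemma sphereFunctional_mul_conj (p : MvPolynomial (Fin d) ℂ) :
    sphereFunctional d (p * conjPoly p) = (sphereNormSq p : ℂ) := by
  rw [sphereNormSq, ← integral_complex_ofReal]
  refine integral_congr_ae (.of_forall fun x => ?_)
  simp only [map_mul, eval_toComplex_conjPoly, Complex.mul_conj, Complex.normSq_eq_norm_sq]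

/-- The radial moments of the Gaussian weight. -/
noncomputable def radialMoment (d n : ℕ) : ℝ :=
  ∫ r : Set.Ioi (0 : ℝ), r.1 ^ n * Real.exp (-(r.1 ^ 2 / 2)) ∂(Measure.volumeIoiPow (d - 1))

lemma gaussFunctional_eq {p : MvPolynomial (Fin d) ℂ} {n : ℕ} (hd : 1 ≤ d)
    (hp : p.IsHomogeneous n) :
    gaussFunctional d p = radialMoment d n * sphereFunctional d p := by
  have : Nontrivial (EuclideanSpace ℝ (Fin d)) := by
    have : Nonempty (Fin d) := ⟨⟨0, hd⟩⟩
    infer_instance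
  set F : EuclideanSpace ℝ (Fin d) → ℂ := fun x => eval (toComplex x) p * (gaussWeight x : ℂ)
  let G : Metric.sphere (0 : EuclideanSpace ℝ (Fin d)) 1 × Set.Ioi (0 : ℝ) → ℂ :=
    fun y => eval (toComplex y.1.1) p * ((y.2.1 ^ n * Real.exp (-(y.2.1 ^ 2 / 2)) : ℝ) : ℂ)
  have key := (volume : Measure (EuclideanSpace ℝ
    (Fin d))).measurePreserving_homeomorphUnitSphereProd.integral_comp
      (Homeomorph.measurableEmbedding _) G
  have hG : ∀ x : ({(0 : EuclideanSpace ℝ (Fin d))}ᶜ : Set (EuclideanSpace ℝ (Fin d))),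
      G (homeomorphUnitSphereProd _ x) = F x := by
    intro x
    have hx : ‖x.1‖ ≠ 0 := norm_ne_zero_iff.2 x.2
    have e : x.1 = ‖x.1‖ • (homeomorphUnitSphereProd _ x).1.1 := by
      simp [smul_smul, hx]
    simp only [F, G, gaussWeight]
    conv_rhs => rw [e]
    rw [toComplex_smul, eval_smul_of_isHomogeneous hp, ← e]
    simp
    ring
  have h1 : gaussFunctional d p = ∫ x : ({(0 : EuclideanSpace ℝ (Fin d))}ᶜ :
      Set (EuclideanSpace ℝ (Fin d))), F x.1
        ∂((volume : Measure (EuclideanSpace ℝ (Fin d))).comap Subtype.val) := by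
    rw [integral_subtype_comap (measurableSet_singleton _).compl F, restrict_compl_singleton]
    rfl
  rw [h1, ← integral_congr_ae (.of_forall hG), key, integral_prod_mul
    (fun θ : Metric.sphere (0 : EuclideanSpace ℝ (Fin d)) 1 => eval (toComplex θ.1) p)
    (fun r : Set.Ioi (0 : ℝ) => ((r.1 ^ n * Real.exp (-(r.1 ^ 2 / 2)) : ℝ) : ℂ)), mul_comm,
    integral_complex_ofReal]
  simp [radialMoment, sphereFunctional]

lemma sphereMeasure_univ_pos (hd : 1 ≤ d) : 0 < (sphereMeasure d).real Set.univ := by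
  have : Nontrivial (EuclideanSpace ℝ (Fin d)) := by
    have : Nonempty (Fin d) := ⟨⟨0, hd⟩⟩
    infer_instance
  exact ENNReal.toReal_pos (fun h => Measure.toSphere_ne_zero _ (Measure.measure_univ_eq_zero.1 h))
    (measure_ne_top _ _)

lemma sphereNormSq_C (c : ℂ) :
    sphereNormSq (C c : MvPolynomial (Fin d) ℂ) = ‖c‖ ^ 2 * (sphereMeasure d).real Set.univ := by
  simp [sphereNormSq, mul_comm]

lemma isHomogeneous_sum_X_sq (d : ℕ) :
    (∑ i : Fin d, X i * X i : MvPolynomial (Fin d) ℂ).IsHomogeneous 2 :=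
  IsHomogeneous.sum _ _ _ fun i _ => (isHomogeneous_X ℂ i).mul (isHomogeneous_X ℂ i)

lemma eval_sum_X_sq (θ : Metric.sphere (0 : EuclideanSpace ℝ (Fin d)) 1) :
    eval (toComplex θ.1) (∑ i : Fin d, X i * X i : MvPolynomial (Fin d) ℂ) = 1 := by
  have h : ‖θ.1‖ = 1 := by simp
  have h2 := EuclideanSpace.real_norm_sq_eq θ.1
  rw [h] at h2
  simp only [map_sum, map_mul, eval_X, toComplex, ← Complex.ofReal_mul]
  rw [← Complex.ofReal_sum, ← Complex.ofReal_one]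
  congr 1
  rw [one_pow] at h2
  exact (Finset.sum_congr rfl fun i _ => (sq _).symm).trans h2.symm

lemma gaussFunctional_sum_X_sq_mul {p : MvPolynomial (Fin d) ℂ} {n : ℕ} (hp : p.IsHomogeneous n) :
    gaussFunctional d ((∑ i, X i * X i) * p) = (n + d) * gaussFunctional d p := by
  have h1 : (n : ℂ) * gaussFunctional d p = ∑ i, gaussFunctional d (X i * pderiv i p) := by
    rw [← map_sum, hp.sum_X_mul_pderiv, map_nsmul, nsmul_eq_mul]
  rw [add_mul, h1, Finset.sum_mul, map_sum]
  have h2 : ∀ i, gaussFunctional d (X i * X i * p) =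
      gaussFunctional d (X i * pderiv i p) + gaussFunctional d p := fun i => by
    rw [mul_assoc, isGaussian_gaussFunctional.X_mul, pderiv_mul, pderiv_X_self, one_mul, map_add,
      add_comm]
  simp [h2, Finset.sum_add_distrib]

/-- The rule for multiplication by `|x|²` is tested on `|x|^(2l)`, which equals `1` on the sphere,
so the spherical factors cancel and no integral has to be computed. -/
lemma radialMoment_add_two (hd : 1 ≤ d) (l : ℕ) :
    radialMoment d (2 * l + 2) = (2 * l + d) * radialMoment d (2 * l) := by
  set p : MvPolynomial (Fin d) ℂ := (∑ i, X i * X i) ^ l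
  have hp : p.IsHomogeneous (2 * l) := (isHomogeneous_sum_X_sq d).pow l
  have h := gaussFunctional_sum_X_sq_mul hp
  rw [gaussFunctional_eq hd ((isHomogeneous_sum_X_sq d).mul hp), gaussFunctional_eq hd hp] at h
  have h1 : ∀ j, sphereFunctional d ((∑ i, X i * X i) ^ j) = (sphereMeasure d).real Set.univ := by
    intro j
    simp only [sphereFunctional, LinearMap.coe_mk, AddHom.coe_mk, map_pow, eval_sum_X_sq, one_pow]
    simp
  have h2 : sphereFunctional d ((∑ i, X i * X i) * p) = (sphereMeasure d).real Set.univ := by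
    rw [← h1 (l + 1), pow_succ']
  rw [h1 l, h2] at h
  have h3 : ((sphereMeasure d).real Set.univ : ℂ) ≠ 0 := by
    exact_mod_cast (sphereMeasure_univ_pos hd).ne'
  rw [← mul_assoc] at h
  have h4 := mul_right_cancel₀ h3 h
  rw [add_comm]
  exact_mod_cast h4

lemma radialMoment_pos (hd : 1 ≤ d) (l : ℕ) : 0 < radialMoment d (2 * l) := by
  induction l with
  | zero =>
    have h0 := gaussFunctional_eq hd (isHomogeneous_one (Fin d) ℂ)
    have h1 : gaussFunctional d 1 =
        ((∫ x : EuclideanSpace ℝ (Fin d), gaussWeight x : ℝ) : ℂ) := by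
      simp [gaussFunctional, integral_complex_ofReal]
    have h2 : sphereFunctional d 1 = ((sphereMeasure d).real Set.univ : ℂ) := by
      simp [sphereFunctional]
    rw [h1, h2] at h0
    have h3 : 0 < ∫ x : EuclideanSpace ℝ (Fin d), gaussWeight x := by
      refine integral_exp_pos ?_
      refine (integrable_eval_mul_gaussWeight (1 : MvPolynomial (Fin d) ℂ)).norm.congr
        (.of_forall fun x => ?_)
      simp only [map_one, one_mul, Complex.norm_real]
      exact Real.norm_of_nonneg (Real.exp_pos _).le
    have h4 : ∫ x : EuclideanSpace ℝ (Fin d), gaussWeight x =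
        radialMoment d 0 * (sphereMeasure d).real Set.univ := by exact_mod_cast h0
    rw [h4] at h3
    exact (mul_pos_iff_of_pos_right (sphereMeasure_univ_pos hd)).1 h3
  | succ l ih =>
    rw [mul_add, mul_one, radialMoment_add_two hd]
    have : (0 : ℝ) < d := by exact_mod_cast hd
    positivity

lemma gaussFunctional_mul_conj (hd : 1 ≤ d) {p : MvPolynomial (Fin d) ℂ} {l : ℕ}
    (hp : p.IsHomogeneous l) :
    gaussFunctional d (p * conjPoly p) = ((radialMoment d (2 * l) * sphereNormSq p : ℝ) : ℂ) := by
  rw [gaussFunctional_eq hd (hp.mul (hp.map _)), sphereFunctional_mul_conj, ← two_mul]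
  push_cast
  rfl

/-- The Gaussian gradient estimate carries the radial moments of orders `2l` and `2l + 2` on its two
sides; their ratio is the factor `2 * l + d`. -/
lemma sphereNormSq_pderiv_le (hd : 1 ≤ d) {p : MvPolynomial (Fin d) ℂ} {l : ℕ}
    (hp : p.IsHomogeneous (l + 1)) (i : Fin d) :
    sphereNormSq (pderiv i p) ≤ (l + 1) * (2 * l + d) * sphereNormSq p := by
  have h := isGaussian_gaussFunctional.sum_pderiv_le hp
  have hq : ∀ j, (pderiv j p).IsHomogeneous l := fun j => hp.pderiv
  rw [gaussFunctional_mul_conj hd hp] at h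
  simp only [fun j => gaussFunctional_mul_conj hd (hq j)] at h
  rw [← Complex.ofReal_sum, ← Complex.ofReal_natCast, ← Complex.ofReal_mul,
    Complex.real_le_real] at h
  have h1 : radialMoment d (2 * l) * sphereNormSq (pderiv i p) ≤
      ((l + 1 : ℕ) : ℝ) * (radialMoment d (2 * (l + 1)) * sphereNormSq p) :=
    le_trans (Finset.single_le_sum (f := fun j => radialMoment d (2 * l) *
      sphereNormSq (pderiv j p)) (fun j _ => mul_nonneg (radialMoment_pos hd l).le
      (sphereNormSq_nonneg _)) (Finset.mem_univ i)) h
  rw [mul_add, mul_one, radialMoment_add_two hd] at h1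
  refine le_of_mul_le_mul_left (h1.trans (le_of_eq ?_)) (radialMoment_pos hd l)
  push_cast
  ring

/-! ### The `L²` norm on the sphere and pointwise bounds on `ℂ^d`. -/

/-- The norm in `L²` of the unit sphere. -/
noncomputable def sphereNorm (p : MvPolynomial (Fin d) ℂ) : ℝ := √(sphereNormSq p)

lemma sphereNorm_nonneg (p : MvPolynomial (Fin d) ℂ) : 0 ≤ sphereNorm p := Real.sqrt_nonneg _

lemma sphereNorm_sq (p : MvPolynomial (Fin d) ℂ) : sphereNorm p ^ 2 = sphereNormSq p :=
  Real.sq_sqrt (sphereNormSq_nonneg p)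

/-- A homogeneous polynomial is controlled on all of `ℂ^d` by its norm in `L²` of the real unit
sphere. -/
lemma norm_eval_le_sphereNorm (hd : 1 ≤ d) (l : ℕ) :
    ∀ (p : MvPolynomial (Fin d) ℂ), p.IsHomogeneous l → ∀ z : Fin d → ℂ,
      ‖eval z p‖ ≤ (√((sphereMeasure d).real Set.univ))⁻¹ * ((d + 2) ^ 2 : ℝ) ^ l * ‖z‖ ^ l *
        sphereNorm p := by
  have hS := Real.sqrt_pos.2 (sphereMeasure_univ_pos hd)
  set S := √((sphereMeasure d).real Set.univ)
  induction l with
  | zero =>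
    intro p hp z
    rw [← totalDegree_zero_iff_isHomogeneous, totalDegree_eq_zero_iff_eq_C] at hp
    rw [hp, eval_C, sphereNorm, sphereNormSq_C, Real.sqrt_mul (by positivity),
      Real.sqrt_sq (norm_nonneg _)]
    refine le_of_eq ?_
    simp only [pow_zero, mul_one]
    field_simp
    rfl
  | succ l ih =>
    intro p hp z
    have hl : (0 : ℝ) < l + 1 := by positivity
    have h0 : ((l + 1 : ℕ) : ℂ) * eval z p = ∑ i, z i * eval z (pderiv i p) := by
      have := congrArg (eval z) hp.sum_X_mul_pderiv
      rw [map_sum, map_nsmul, nsmul_eq_mul] at this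
      rw [← this]
      simp
    -- The factor `l + 1` lost by differentiating is the one that Euler's identity `(l + 1) p = ∑
    -- z_i ∂_i p` gives back, so each degree costs only a constant.
    have hN : ∀ i, sphereNorm (pderiv i p) ≤ ((l + 1) * (d + 2)) * sphereNorm p := by
      intro i
      rw [sphereNorm, sphereNorm]
      refine (Real.sqrt_le_sqrt (sphereNormSq_pderiv_le hd hp i)).trans ?_
      rw [Real.sqrt_mul (by positivity)]
      refine mul_le_mul_of_nonneg_right ?_ (Real.sqrt_nonneg _)
      rw [Real.sqrt_le_left (by positivity)]
      have hd' : (0 : ℝ) ≤ d := by positivity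
      have hl' : (0 : ℝ) ≤ l := by positivity
      nlinarith [mul_nonneg hl' hd', mul_nonneg (mul_nonneg hl' hd') hl',
        mul_nonneg (mul_nonneg hl' hd') hd', mul_nonneg hl' hl', mul_nonneg hd' hd',
        mul_nonneg (mul_nonneg hl' hl') (mul_nonneg hd' hd')]
    set K : ℝ := S⁻¹ * ((d + 2) ^ 2 : ℝ) ^ l * ‖z‖ ^ l with hK
    have hK0 : 0 ≤ K := by positivity
    have h1 : (l + 1 : ℝ) * ‖eval z p‖ ≤ d * (‖z‖ * (K * (((l + 1) * (d + 2)) * sphereNorm p))) := by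
      have e : (l + 1 : ℝ) * ‖eval z p‖ = ‖((l + 1 : ℕ) : ℂ) * eval z p‖ := by
        rw [norm_mul, Complex.norm_natCast]
        push_cast
        rfl
      rw [e, h0]
      refine (norm_sum_le _ _).trans ?_
      have : ∀ i ∈ Finset.univ, ‖z i * eval z (pderiv i p)‖ ≤
          ‖z‖ * (K * (((l + 1) * (d + 2)) * sphereNorm p)) := fun i _ => by
        rw [norm_mul]
        refine mul_le_mul (norm_le_pi_norm z i) ?_ (norm_nonneg _) (norm_nonneg _)
        exact (ih _ hp.pderiv z).trans (mul_le_mul_of_nonneg_left (hN i) hK0)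
      refine (Finset.sum_le_card_nsmul _ _ _ this).trans ?_
      simp
    have h2 : (l + 1 : ℝ) * ‖eval z p‖ ≤
        (l + 1) * (S⁻¹ * ((d + 2) ^ 2 : ℝ) ^ (l + 1) * ‖z‖ ^ (l + 1) * sphereNorm p) := by
      refine h1.trans ?_
      have e : (l + 1 : ℝ) * (S⁻¹ * ((d + 2) ^ 2 : ℝ) ^ (l + 1) * ‖z‖ ^ (l + 1) * sphereNorm p) =
        ((d + 2 : ℝ) * (d + 2)) * (‖z‖ * K * (l + 1) * sphereNorm p) := by rw [hK]; ring
      rw [e]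
      have e2 : d * (‖z‖ * (K * (((l + 1) * (d + 2)) * sphereNorm p))) =
        ((d : ℝ) * (d + 2)) * (‖z‖ * K * (l + 1) * sphereNorm p) := by ring
      rw [e2]
      have := sphereNorm_nonneg p
      gcongr
      linarith
    exact le_of_mul_le_mul_left h2 hl

lemma integral_norm_mul_norm_le (p q : MvPolynomial (Fin d) ℂ) :
    ∫ θ, ‖eval (toComplex θ.1) p‖ * ‖eval (toComplex θ.1) q‖ ∂(sphereMeasure d) ≤
      sphereNorm p * sphereNorm q := by
  have hm : ∀ p : MvPolynomial (Fin d) ℂ,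
      MemLp (fun θ : Metric.sphere (0 : EuclideanSpace ℝ (Fin d)) 1 => eval (toComplex θ.1) p)
        (ENNReal.ofReal 2) (sphereMeasure d) := fun p =>
    (continuous_eval_sphere p).memLp_of_hasCompactSupport (HasCompactSupport.of_compactSpace _)
  have h := integral_mul_norm_le_Lp_mul_Lq Real.HolderConjugate.two_two (hm p) (hm q)
  have e : ∀ p : MvPolynomial (Fin d) ℂ,
      (∫ θ, ‖eval (toComplex θ.1) p‖ ^ (2 : ℝ) ∂(sphereMeasure d)) ^ (1 / 2 : ℝ) = sphereNorm p := by
    intro p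
    rw [sphereNorm, sphereNormSq, Real.sqrt_eq_rpow]
    simp only [Real.rpow_two]
  rwa [e, e] at h

lemma norm_sphereFunctional_mul_conj_le (p q : MvPolynomial (Fin d) ℂ) :
    ‖sphereFunctional d (p * conjPoly q)‖ ≤ sphereNorm p * sphereNorm q := by
  refine le_trans ?_ (integral_norm_mul_norm_le p q)
  refine (norm_integral_le_integral_norm _).trans (le_of_eq ?_)
  refine integral_congr_ae (.of_forall fun x => ?_)
  simp only [map_mul, eval_toComplex_conjPoly, norm_mul, RCLike.norm_conj]

lemma sphereNorm_zero : sphereNorm (0 : MvPolynomial (Fin d) ℂ) = 0 := by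
  simp [sphereNorm, sphereNormSq]

lemma sphereNorm_le_of_forall_le {p : MvPolynomial (Fin d) ℂ} {B : ℝ} (hB : 0 ≤ B)
    (h : ∀ x : EuclideanSpace ℝ (Fin d), ‖x‖ = 1 → ‖eval (toComplex x) p‖ ≤ B) :
    sphereNorm p ≤ B * √((sphereMeasure d).real Set.univ) := by
  rw [sphereNorm, Real.sqrt_le_left (by positivity), mul_pow, Real.sq_sqrt measureReal_nonneg]
  have : sphereNormSq p ≤ ∫ θ, B ^ 2 ∂(sphereMeasure d) :=
    integral_mono (integrable_sphereMeasure ((continuous_eval_sphere p).norm.pow 2))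
      (integrable_const _) fun θ =>
        pow_le_pow_left₀ (norm_nonneg _) (h θ.1 (by simp)) 2
  simpa [mul_comm] using this

lemma exists_sphereNorm_mul_le (p : MvPolynomial (Fin d) ℂ) :
    ∃ c : ℝ, 0 ≤ c ∧ ∀ q, sphereNorm (p * q) ≤ c * sphereNorm q := by
  obtain ⟨A, hA⟩ := norm_eval_toComplex_le_exp p one_pos
  refine ⟨|A * Real.exp 1|, abs_nonneg _, fun q => ?_⟩
  have h : sphereNormSq (p * q) ≤ |A * Real.exp 1| ^ 2 * sphereNormSq q := by
    rw [sphereNormSq, sphereNormSq, ← integral_const_mul]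
    refine integral_mono (integrable_sphereMeasure ((continuous_eval_sphere _).norm.pow 2))
      (integrable_sphereMeasure (((continuous_eval_sphere _).norm.pow 2).const_mul _)) fun θ => ?_
    have h1 : ‖θ.1‖ = 1 := by simp
    have h2 := hA θ.1
    simp only [h1, one_pow, mul_one] at h2
    simp only [map_mul, norm_mul, mul_pow]
    exact mul_le_mul_of_nonneg_right (pow_le_pow_left₀ (norm_nonneg _) (h2.trans (le_abs_self _)) 2)
      (by positivity)
  rw [sphereNorm, sphereNorm]
  refine (Real.sqrt_le_sqrt h).trans (le_of_eq ?_)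
  rw [Real.sqrt_mul (by positivity), Real.sqrt_sq (abs_nonneg _)]

lemma eq_zero_of_sphereNorm_eq_zero (hd : 1 ≤ d) {p : MvPolynomial (Fin d) ℂ} {l : ℕ}
    (hp : p.IsHomogeneous l) (h : sphereNorm p = 0) : p = 0 := by
  refine MvPolynomial.funext fun z => ?_
  have := norm_eval_le_sphereNorm hd l p hp z
  rw [h, mul_zero] at this
  simpa using this

/-! ### Division of homogeneous polynomials with estimates. -/

lemma sphereFunctional_mul_conj_eq_zero (hd : 1 ≤ d) {k n : ℕ} {h q : MvPolynomial (Fin d) ℂ}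
    (hh : h.IsHomogeneous (n + 2 * k)) (hk : (polyLaplacian d ^ k) h = 0)
    (hq : q.IsHomogeneous n) : sphereFunctional d (h * conjPoly q) = 0 := by
  have h1 := isGaussian_gaussFunctional.mul_eq_zero_of_polyLaplacian_pow n hh le_rfl hk
    (hq.map (starRingEnd ℂ))
  rw [gaussFunctional_eq hd (hh.mul (hq.map _)), show n + 2 * k + n = 2 * (n + k) by ring] at h1
  have h2 : (radialMoment d (2 * (n + k)) : ℂ) ≠ 0 := by
    exact_mod_cast (radialMoment_pos hd _).ne'
  exact (mul_eq_zero.1 h1).resolve_left h2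

/-- A homogeneous polynomial `f` of degree at least `2 * k` is `P * q + r` with `r` being
`k`-harmonic and `q` controlled by `f`, if `P` is bounded from below in the `L²` sense. -/
lemma exists_fischer_decomposition (hd : 1 ≤ d) {k : ℕ}
    {P : MvPolynomial (Fin d) ℂ} (hP : P.IsHomogeneous (2 * k)) {n : ℕ}
    {c : ℝ} (hc : 0 < c)
    (hineq : ∀ q : MvPolynomial (Fin d) ℂ, q.IsHomogeneous n →
      ((1 / c : ℝ) : ℂ) * sphereInner q q ≤ sphereInner (P * q) q)
    {f : MvPolynomial (Fin d) ℂ} (hf : f.IsHomogeneous (n + 2 * k)) :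
    ∃ q : MvPolynomial (Fin d) ℂ, q.IsHomogeneous n ∧ (polyLaplacian d ^ k) (f - P * q) = 0 ∧
      sphereNorm q ≤ c * sphereNorm f := by
  -- The remainder is orthogonal to `q`, so `⟨P q, q⟩ = ⟨g, q⟩`. This one estimate gives injectivity
  -- (with `g = 0`) as well as the final bound (with `g = f`).
  have key : ∀ g q : MvPolynomial (Fin d) ℂ, g.IsHomogeneous (n + 2 * k) → q.IsHomogeneous n →
      (polyLaplacian d ^ k) (g - P * q) = 0 → sphereNorm q ≤ c * sphereNorm g := by
    intro g q hg hq h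
    have hPq : (P * q).IsHomogeneous (n + 2 * k) := by
      rw [add_comm]; exact hP.mul hq
    have h1 := sphereFunctional_mul_conj_eq_zero hd (hg.sub hPq) h hq
    rw [sub_mul, map_sub, sub_eq_zero] at h1
    have h2 := hineq q hq
    rw [sphereInner_eq, sphereInner_eq, ← h1, sphereFunctional_mul_conj, ← Complex.ofReal_mul] at h2
    have h3 := (Complex.le_def.1 h2).1
    rw [Complex.ofReal_re] at h3
    have h4 : 1 / c * sphereNormSq q ≤ sphereNorm g * sphereNorm q :=
      h3.trans ((Complex.re_le_norm _).trans (norm_sphereFunctional_mul_conj_le g q))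
    rw [← sphereNorm_sq, div_mul_eq_mul_div, one_mul, div_le_iff₀ hc] at h4
    rcases (sphereNorm_nonneg q).eq_or_lt with h0 | h0
    · rw [← h0]
      exact mul_nonneg hc.le (sphereNorm_nonneg g)
    · nlinarith
  let L : Module.End ℂ (MvPolynomial (Fin d) ℂ) := (polyLaplacian d ^ k) ∘ₗ LinearMap.mulLeft ℂ P
  have hL : ∀ q ∈ homogeneousSubmodule (Fin d) ℂ n, L q ∈ homogeneousSubmodule (Fin d) ℂ n := by
    intro q hq
    have := isHomogeneous_polyLaplacian_pow (hP.mul hq) k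
    rwa [Nat.add_sub_cancel_left] at this
  have : Module.Finite ℂ (homogeneousSubmodule (Fin d) ℂ n) :=
    Module.Finite.iff_fg.2 (homogeneousSubmodule_fg (Fin d) ℂ n)
  have hinj : Function.Injective (L.restrict hL) := by
    rw [injective_iff_map_eq_zero]
    rintro ⟨q, hq⟩ h
    have h1 : (polyLaplacian d ^ k) (P * q) = 0 := congrArg Subtype.val h
    have h2 := key 0 q (isHomogeneous_zero _ _ _) hq (by rw [zero_sub, map_neg, h1, neg_zero])
    rw [sphereNorm_zero, mul_zero] at h2
    exact Subtype.ext (eq_zero_of_sphereNorm_eq_zero hd hq (le_antisymm h2 (sphereNorm_nonneg q)))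
  have hfk : (polyLaplacian d ^ k) f ∈ homogeneousSubmodule (Fin d) ℂ n := by
    have := isHomogeneous_polyLaplacian_pow hf k
    rwa [Nat.add_sub_cancel] at this
  obtain ⟨⟨q, hq⟩, h⟩ := LinearMap.injective_iff_surjective.1 hinj ⟨_, hfk⟩
  have h1 : (polyLaplacian d ^ k) (P * q) = (polyLaplacian d ^ k) f := congrArg Subtype.val h
  have h2 : (polyLaplacian d ^ k) (f - P * q) = 0 := by rw [map_sub, h1, sub_self]
  exact ⟨q, hq, h2, key f q hf hq h2⟩

/-- Strong induction on the degree: divide by `P` to get `q₀`, then divide the products `Q j * q₀`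
by the full polynomial. The quotient is chosen before `R` and `X`, and `X` is only required to
dominate `m + D`, so the same `X` serves at every level of the recursion. -/
lemma exists_quotient (hd : 1 ≤ d) {k : ℕ} {P : MvPolynomial (Fin d) ℂ}
    (hP : P.IsHomogeneous (2 * k)) {C D α : ℝ} (hC : 0 < C) (hD : 0 < D) (hα : 0 ≤ α)
    (hineq : ∀ (m : ℕ) (q : MvPolynomial (Fin d) ℂ), q.IsHomogeneous m →
      ((1 / (C * ((m : ℝ) + D) ^ α) : ℝ) : ℂ) * sphereInner q q ≤ sphereInner (P * q) q)
    {β : ℕ} (hβ : β < 2 * k) {Q : ℕ → MvPolynomial (Fin d) ℂ}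
    (hQ : ∀ j ≤ β, (Q j).IsHomogeneous j) :
    ∃ A B : ℝ, 0 < A ∧ 0 < B ∧ ∀ (m : ℕ) (f : MvPolynomial (Fin d) ℂ), f.IsHomogeneous m →
      ∃ q : MvPolynomial (Fin d) ℂ,
        (polyLaplacian d ^ k) (f - (P - ∑ j ∈ Finset.range (β + 1), Q j) * q) = 0 ∧
        ∀ R X : ℝ, 0 ≤ R → 1 ≤ X → m + D ≤ X → ∀ z : Fin d → ℂ, ‖z‖ ≤ R →
          ‖eval z q‖ ≤ B * (A * (R + X ^ (α / (2 * k - β)))) ^ m * sphereNorm f := by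
  choose c hc0 hc using fun j => exists_sphereNorm_mul_le (Q j)
  set S : ℝ := ∑ j ∈ Finset.range (β + 1), c j with hS
  have hS0 : 0 ≤ S := Finset.sum_nonneg fun j _ => hc0 j
  set K0 : ℝ := (√((sphereMeasure d).real Set.univ))⁻¹
  have hK0 : 0 < K0 := inv_pos.2 (Real.sqrt_pos.2 (sphereMeasure_univ_pos hd))
  set K : ℝ := (d + 2) ^ 2
  have hK1 : 1 ≤ K := one_le_pow₀ (by linarith [Nat.cast_nonneg (α := ℝ) d])
  -- `A ≥ K` absorbs the pointwise bound of `q₀`, and `C * S ≤ A / 2` pays for the recursive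
  -- quotients, whose degrees are smaller by at least one. With `B = 2 * K0 * C`, each of the two
  -- contributions takes half of the final bound.
  set A : ℝ := K + 2 * C * S with hA
  have hCS : 0 ≤ C * S := mul_nonneg hC.le hS0
  have hA1 : 1 ≤ A := by rw [hA]; linarith
  set B : ℝ := 2 * K0 * C with hB
  have hB0 : 0 < B := by positivity
  refine ⟨A, B, by linarith, hB0, fun m => ?_⟩
  induction m using Nat.strong_induction_on with
  | _ m ih =>
    intro f hf
    by_cases hm : m < 2 * k
    · refine ⟨0, by rw [mul_zero, sub_zero, polyLaplacian_pow_eq_zero hf hm],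
        fun R X hR hX _ z _ => ?_⟩
      rw [map_zero, norm_zero]
      have := sphereNorm_nonneg f
      have : 0 ≤ X ^ (α / (2 * k - β)) := Real.rpow_nonneg (by linarith) _
      positivity
    obtain ⟨n, rfl⟩ : ∃ n, m = n + 2 * k := ⟨m - 2 * k, by omega⟩
    have hnD : (0 : ℝ) < n + D := by positivity
    obtain ⟨q₀, hq₀, hr₀, hN⟩ := exists_fischer_decomposition hd hP
      (c := C * ((n : ℝ) + D) ^ α) (mul_pos hC (Real.rpow_pos_of_pos hnD _)) (hineq n) hf
    have hdeg : ∀ j ∈ Finset.range (β + 1), j ≤ β := fun j hj => by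
      rw [Finset.mem_range] at hj; omega
    choose! q hqr hqb using fun j (hj : j ≤ β) =>
      ih (j + n) (by omega) (Q j * q₀) ((hQ j hj).mul hq₀)
    refine ⟨q₀ + ∑ j ∈ Finset.range (β + 1), q j, ?_, fun R X hR hX hXm z hz => ?_⟩
    · set W := P - ∑ j ∈ Finset.range (β + 1), Q j with hW
      have e : f - W * (q₀ + ∑ j ∈ Finset.range (β + 1), q j) =
          (f - P * q₀) + ∑ j ∈ Finset.range (β + 1), (Q j * q₀ - W * q j) := by
        rw [Finset.sum_sub_distrib, ← Finset.mul_sum, ← Finset.sum_mul, mul_add]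
        have : W * q₀ = P * q₀ - (∑ j ∈ Finset.range (β + 1), Q j) * q₀ := by rw [hW, sub_mul]
        rw [this]
        abel
      rw [e, map_add, hr₀, zero_add, map_sum]
      exact Finset.sum_eq_zero fun j hj => hqr j (hdeg j hj)
    · set Y : ℝ := R + X ^ (α / (2 * k - β)) with hY
      have hkβ : (0 : ℝ) < 2 * k - β := by
        have : (β : ℝ) < 2 * k := by exact_mod_cast hβ
        linarith
      have hXa1 : 1 ≤ X ^ (α / (2 * k - β)) := Real.one_le_rpow hX (by positivity)
      have hY1 : 1 ≤ Y := by linarith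
      -- The choice of exponent: the cost `X ^ α` of one division is paid by the `2 * k - β` degrees
      -- that it gains. The exponent on the right is a natural number.
      have hXα : X ^ α ≤ Y ^ (2 * k - β) := by
        have e : X ^ α = (X ^ (α / (2 * k - β))) ^ (2 * k - β : ℕ) := by
          rw [← Real.rpow_natCast, ← Real.rpow_mul (by linarith), Nat.cast_sub hβ.le]
          push_cast
          rw [div_mul_cancel₀ _ hkβ.ne']
        rw [e]
        exact pow_le_pow_left₀ (by linarith) (by linarith) _
      have hf0 := sphereNorm_nonneg f
      have hNq : sphereNorm q₀ ≤ C * Y ^ (2 * k - β) * sphereNorm f := by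
        refine hN.trans ?_
        gcongr
        refine le_trans (Real.rpow_le_rpow hnD.le ?_ hα) hXα
        push_cast at hXm
        have : (0 : ℝ) ≤ k := by positivity
        linarith
      have h1 : ‖eval z q₀‖ ≤ K0 * C * (A * Y) ^ (n + 2 * k) * sphereNorm f := by
        refine (norm_eval_le_sphereNorm hd n q₀ hq₀ z).trans ?_
        calc K0 * K ^ n * ‖z‖ ^ n * sphereNorm q₀
            ≤ K0 * A ^ n * Y ^ n * (C * Y ^ (2 * k - β) * sphereNorm f) := by
              have : K ≤ A := by rw [hA]; linarith
              have : ‖z‖ ≤ Y := by linarith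
              gcongr
              exact sphereNorm_nonneg _
          _ = K0 * C * (A ^ n * Y ^ (n + (2 * k - β))) * sphereNorm f := by ring
          _ ≤ K0 * C * (A ^ (n + 2 * k) * Y ^ (n + 2 * k)) * sphereNorm f := by
              have e1 : A ^ n ≤ A ^ (n + 2 * k) := pow_le_pow_right₀ hA1 (by omega)
              have e2 : Y ^ (n + (2 * k - β)) ≤ Y ^ (n + 2 * k) := pow_le_pow_right₀ hY1 (by omega)
              exact mul_le_mul_of_nonneg_right (mul_le_mul_of_nonneg_left
                (mul_le_mul e1 e2 (by positivity) (by positivity)) (by positivity)) hf0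
          _ = _ := by rw [mul_pow]
      have h2 : ∀ j ∈ Finset.range (β + 1), ‖eval z (q j)‖ ≤
          c j * (B * C * A ^ (n + 2 * k - 1) * Y ^ (n + 2 * k) * sphereNorm f) := by
        intro j hj
        have hj' := hdeg j hj
        refine (hqb j hj' R X hR hX ?_ z hz).trans ?_
        · refine le_trans ?_ hXm
          have : ((j + n : ℕ) : ℝ) ≤ ((n + 2 * k : ℕ) : ℝ) := by
            exact_mod_cast (by omega : j + n ≤ n + 2 * k)
          linarith
        calc B * (A * Y) ^ (j + n) * sphereNorm (Q j * q₀)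
            ≤ B * (A * Y) ^ (j + n) * (c j * (C * Y ^ (2 * k - β) * sphereNorm f)) := by
              gcongr
              exact (hc j q₀).trans (mul_le_mul_of_nonneg_left hNq (hc0 j))
          _ = c j * (B * C * A ^ (j + n) * Y ^ (j + n + (2 * k - β)) * sphereNorm f) := by
              rw [mul_pow]
              ring
          _ ≤ _ := by
              have e1 : A ^ (j + n) ≤ A ^ (n + 2 * k - 1) := pow_le_pow_right₀ hA1 (by omega)
              have e2 : Y ^ (j + n + (2 * k - β)) ≤ Y ^ (n + 2 * k) :=
                pow_le_pow_right₀ hY1 (by omega)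
              exact mul_le_mul_of_nonneg_left (mul_le_mul_of_nonneg_right (mul_le_mul
                (mul_le_mul_of_nonneg_left e1 (by positivity)) e2 (by positivity)
                (by positivity)) hf0) (hc0 j)
      rw [map_add, map_sum]
      refine (norm_add_le _ _).trans ((add_le_add h1 ((norm_sum_le _ _).trans
        (Finset.sum_le_sum h2))).trans ?_)
      rw [← Finset.sum_mul, ← hS]
      have h3 : S * (B * C * A ^ (n + 2 * k - 1) * Y ^ (n + 2 * k) * sphereNorm f) ≤
          B / 2 * (A * Y) ^ (n + 2 * k) * sphereNorm f := by
        have e : (A * Y) ^ (n + 2 * k) = A * A ^ (n + 2 * k - 1) * Y ^ (n + 2 * k) := by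
          rw [mul_pow, ← pow_succ', Nat.sub_add_cancel (by omega)]
        rw [e]
        have h4 : 0 ≤ B * A ^ (n + 2 * k - 1) * Y ^ (n + 2 * k) * sphereNorm f := by positivity
        have h5 : C * S ≤ A / 2 := by rw [hA]; linarith
        calc _ = (C * S) * (B * A ^ (n + 2 * k - 1) * Y ^ (n + 2 * k) * sphereNorm f) := by ring
          _ ≤ (A / 2) * (B * A ^ (n + 2 * k - 1) * Y ^ (n + 2 * k) * sphereNorm f) :=
              mul_le_mul_of_nonneg_right h5 h4
          _ = _ := by ring
      have h6 : K0 * C = B / 2 := by rw [hB]; ring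
      rw [h6]
      calc _ ≤ B / 2 * (A * Y) ^ (n + 2 * k) * sphereNorm f +
            B / 2 * (A * Y) ^ (n + 2 * k) * sphereNorm f := by gcongr
        _ = _ := by ring

/-! ### Taylor components of entire functions are homogeneous polynomials. -/

/-- The homogeneous component of degree `m` of an entire function. -/
noncomputable def taylorComponent (f : (Fin d → ℂ) → ℂ) (m : ℕ) (z : Fin d → ℂ) : ℂ :=
  (m.factorial : ℂ)⁻¹ * iteratedDeriv m (fun ζ : ℂ => f (ζ • z)) 0

variable {f : (Fin d → ℂ) → ℂ}

lemma differentiable_comp_smul (hf : Differentiable ℂ f) (z : Fin d → ℂ) :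
    Differentiable ℂ fun ζ : ℂ => f (ζ • z) :=
  hf.comp (differentiable_id.smul_const z)

lemma hasSum_taylorComponent (hf : Differentiable ℂ f) (z : Fin d → ℂ) :
    HasSum (fun m => taylorComponent f m z) (f z) := by
  have := Complex.hasSum_taylorSeries_of_entire (differentiable_comp_smul hf z) 0 1
  simpa [taylorComponent] using this

lemma norm_taylorComponent_le (hf : Differentiable ℂ f) {z : Fin d → ℂ} {r M : ℝ} (hr : 0 < r)
    (hM : ∀ ζ : ℂ, ‖ζ‖ = r → ‖f (ζ • z)‖ ≤ M) (m : ℕ) : ‖taylorComponent f m z‖ ≤ M / r ^ m := by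
  have := Complex.norm_iteratedDeriv_le_of_forall_mem_sphere_norm_le m hr
    (differentiable_comp_smul hf z).diffContOnCl (c := 0) (C := M)
    (fun ζ hζ => hM ζ (by simpa using hζ))
  rw [taylorComponent, norm_mul, norm_inv, Complex.norm_natCast, inv_mul_le_iff₀ (by positivity)]
  rwa [← mul_div_assoc]

lemma taylorComponent_smul (hf : Differentiable ℂ f) (m : ℕ) (s : ℂ) (z : Fin d → ℂ) :
    taylorComponent f m (s • z) = s ^ m * taylorComponent f m z := by
  have h : (fun ζ : ℂ => f (ζ • s • z)) = fun ζ => (fun ξ : ℂ => f (ξ • z)) (s * ζ) := by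
    ext ζ
    rw [smul_smul, mul_comm]
  have := congrFun (iteratedDeriv_comp_const_mul (n := m)
    (differentiable_comp_smul hf z).contDiff s) 0
  rw [taylorComponent, h, this, taylorComponent, mul_zero]
  ring

lemma norm_fderiv_le_of_norm_le (hf : Differentiable ℂ f) {R M : ℝ} (hM0 : 0 ≤ M)
    (hM : ∀ z, ‖z‖ ≤ R + 1 → ‖f z‖ ≤ M) {z : Fin d → ℂ} (hz : ‖z‖ ≤ R) : ‖fderiv ℂ f z‖ ≤ M := by
  refine ContinuousLinearMap.opNorm_le_of_unit_norm hM0 fun v hv => ?_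
  have hl : Differentiable ℂ fun t : ℂ => z + t • v := by fun_prop
  have h1 : HasDerivAt (fun t : ℂ => f (z + t • v)) (fderiv ℂ f z v) 0 := by
    have h2 : HasDerivAt (fun t : ℂ => z + t • v) v 0 := by
      simpa using ((hasDerivAt_id (0 : ℂ)).smul_const v).const_add z
    exact (hf z).hasFDerivAt.comp_hasDerivAt_of_eq (0 : ℂ) h2 (by simp)
  rw [← h1.deriv]
  have := Complex.norm_deriv_le_of_forall_mem_sphere_norm_le (c := 0) (C := M) one_pos
    (hf.comp hl).diffContOnCl (fun t ht => hM _ ?_)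
  · rwa [div_one] at this
  · refine (norm_add_le _ _).trans (add_le_add hz ?_)
    rw [norm_smul, hv, mul_one]
    simpa using le_of_eq ht

lemma exists_norm_le_of_norm_le (hf : Differentiable ℂ f) (R : ℝ) :
    ∃ M : ℝ, 0 ≤ M ∧ ∀ z, ‖z‖ ≤ R → ‖f z‖ ≤ M := by
  obtain ⟨M, hM⟩ := (isCompact_closedBall (0 : Fin d → ℂ) R).exists_bound_of_continuousOn
    hf.continuous.continuousOn
  exact ⟨max M 0, le_max_right _ _, fun z hz => (hM z (by simpa using hz)).trans (le_max_left _ _)⟩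

lemma taylorComponent_eq_circleIntegral (hf : Differentiable ℂ f) (m : ℕ) (z : Fin d → ℂ) :
    taylorComponent f m z =
      (2 * Real.pi * Complex.I)⁻¹ * ∮ ζ in C(0, 1), (1 / ζ ^ (m + 1)) * f (ζ • z) := by
  have := (differentiable_comp_smul hf z).differentiableOn.circleIntegral_one_div_sub_center_pow_smul
    (c := 0) (R := 1) one_pos m
  simp only [sub_zero, smul_eq_mul] at this
  rw [this, taylorComponent]
  have h1 : (2 * Real.pi * Complex.I : ℂ) ≠ 0 := Complex.two_pi_I_ne_zero
  field_simp

/-- Cauchy's formula writes the component as an integral over the unit circle, which is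
differentiated under the integral sign. -/
lemma differentiable_taylorComponent_line (hf : Differentiable ℂ f) (m : ℕ) (z v : Fin d → ℂ) :
    Differentiable ℂ fun t : ℂ => taylorComponent f m (z + t • v) := by
  simp only [taylorComponent_eq_circleIntegral hf]
  refine Differentiable.const_mul (fun t₀ => ?_) _
  simp only [circleIntegral, smul_eq_mul]
  set c : ℝ → ℂ := fun θ => circleMap 0 1 θ with hc
  have hcc : Continuous c := continuous_circleMap 0 1
  have hc0 : ∀ θ, c θ ≠ 0 := fun θ => circleMap_ne_center one_ne_zero
  have hcn : ∀ θ, ‖c θ‖ = 1 := fun θ => by simp [hc]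
  have hdc : ∀ θ, deriv (circleMap 0 1) θ = c θ * Complex.I := fun θ => by simp [hc]
  simp only [hdc]
  obtain ⟨M, hM0, hM⟩ := exists_norm_le_of_norm_le hf (‖z‖ + (‖t₀‖ + 1) * ‖v‖ + 1)
  refine (intervalIntegral.hasDerivAt_integral_of_dominated_loc_of_deriv_le
    (F' := fun t θ => c θ * Complex.I * (1 / c θ ^ (m + 1) *
      (c θ * fderiv ℂ f (c θ • (z + t • v)) v)))
    (bound := fun _ => M * ‖v‖) (Metric.ball_mem_nhds t₀ one_pos) ?_ ?_ ?_ ?_ ?_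
      ?_).2.differentiableAt
  · refine .of_forall fun t => Continuous.aestronglyMeasurable ?_
    exact (hcc.mul continuous_const).mul ((continuous_const.div (hcc.pow _)
      fun θ => pow_ne_zero _ (hc0 θ)).mul (hf.continuous.comp (hcc.smul continuous_const)))
  · refine Continuous.intervalIntegrable ?_ _ _
    exact (hcc.mul continuous_const).mul ((continuous_const.div (hcc.pow _)
      fun θ => pow_ne_zero _ (hc0 θ)).mul (hf.continuous.comp (hcc.smul continuous_const)))
  · refine Measurable.aestronglyMeasurable ?_
    have h1 : Measurable fun θ => fderiv ℂ f (c θ • (z + t₀ • v)) v :=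
      (measurable_fderiv_apply_const ℂ f v).comp (hcc.smul continuous_const).measurable
    have := hcc.measurable
    fun_prop
  · refine .of_forall fun θ _ t ht => ?_
    have ht' : ‖t‖ ≤ ‖t₀‖ + 1 := by
      have : ‖t - t₀‖ < 1 := by simpa [dist_eq_norm] using ht
      have := norm_le_norm_add_norm_sub t₀ t
      rw [norm_sub_rev] at this
      linarith
    simp only [norm_mul, norm_div, norm_pow, hcn, norm_one, one_pow, Complex.norm_I, mul_one,
      div_one, one_mul]
    refine (ContinuousLinearMap.le_opNorm _ _).trans
      (mul_le_mul_of_nonneg_right ?_ (norm_nonneg v))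
    refine norm_fderiv_le_of_norm_le hf hM0 hM ?_
    rw [norm_smul, hcn, one_mul]
    refine (norm_add_le _ _).trans (add_le_add le_rfl ?_)
    rw [norm_smul]
    exact mul_le_mul_of_nonneg_right ht' (norm_nonneg v)
  · exact continuous_const.intervalIntegrable _ _
  · refine .of_forall fun θ _ t _ => ?_
    have h2 : HasDerivAt (fun t : ℂ => c θ • (z + t • v)) (c θ • v) t := by
      have := (((hasDerivAt_id' t).smul_const v).const_add z).const_smul (c θ)
      rwa [one_smul] at this
    have h3 := (hf (c θ • (z + t • v))).hasFDerivAt.comp_hasDerivAt t h2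
    rw [map_smul, smul_eq_mul] at h3
    exact (h3.const_mul _).const_mul _

/-- Liouville's argument: Cauchy's inequality on circles of radius `R → ∞` kills all derivatives at
`0` of order above `m`. -/
lemma exists_polynomial_of_growth {g : ℂ → ℂ} (hg : Differentiable ℂ g) {K c : ℝ} {m : ℕ}
    (h : ∀ t, ‖g t‖ ≤ K * (c + ‖t‖) ^ m) :
    ∃ p : Polynomial ℂ, p.degree < (m + 1 : ℕ) ∧ ∀ t, g t = p.eval t := by
  have hz : ∀ n, m < n → iteratedDeriv n g 0 = 0 := by
    intro n hn
    rw [← norm_eq_zero]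
    refine le_antisymm ?_ (norm_nonneg _)
    have hlim : Tendsto (fun R : ℝ => n.factorial * (|K| * 2 ^ m) / R) atTop (nhds 0) :=
      tendsto_const_nhds.div_atTop tendsto_id
    refine ge_of_tendsto hlim ?_
    filter_upwards [eventually_ge_atTop 1, eventually_ge_atTop |c|] with R hR hRc
    have hR0 : 0 < R := by linarith
    have hb := Complex.norm_iteratedDeriv_le_of_forall_mem_sphere_norm_le n hR0
      hg.diffContOnCl (c := 0) (C := |K| * (2 * R) ^ m) (fun t ht => ?_)
    · refine hb.trans ?_
      rw [mul_div_assoc, mul_div_assoc (n.factorial : ℝ)]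
      refine mul_le_mul_of_nonneg_left ?_ (Nat.cast_nonneg _)
      rw [div_le_div_iff₀ (by positivity) hR0, mul_pow]
      calc |K| * (2 ^ m * R ^ m) * R = |K| * 2 ^ m * R ^ (m + 1) := by ring
        _ ≤ |K| * 2 ^ m * R ^ n :=
          mul_le_mul_of_nonneg_left (pow_le_pow_right₀ hR hn) (by positivity)
    · have ht' : ‖t‖ = R := by simpa using ht
      refine (h t).trans ?_
      rw [ht']
      refine (le_abs_self _).trans ?_
      rw [abs_mul, abs_pow]
      refine mul_le_mul_of_nonneg_left (pow_le_pow_left₀ (abs_nonneg _) ?_ m) (abs_nonneg K)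
      refine (abs_add_le _ _).trans ?_
      rw [abs_of_pos hR0]
      linarith
  refine ⟨∑ n ∈ Finset.range (m + 1), Polynomial.C ((n.factorial : ℂ)⁻¹ * iteratedDeriv n g 0) *
    Polynomial.X ^ n, ?_, fun t => ?_⟩
  · refine (Polynomial.degree_sum_le _ _).trans_lt ?_
    rw [Finset.sup_lt_iff (WithBot.bot_lt_coe _)]
    intro n hn
    refine (Polynomial.degree_C_mul_X_pow_le _ _).trans_lt ?_
    exact_mod_cast Finset.mem_range.1 hn
  · have h1 := Complex.hasSum_taylorSeries_of_entire hg 0 t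
    have h2 := hasSum_sum_of_ne_finset_zero (L := SummationFilter.unconditional ℕ)
      (s := Finset.range (m + 1))
      (f := fun n => ((n.factorial : ℂ)⁻¹ • (t - 0) ^ n • iteratedDeriv n g 0)) (fun n hn => by
        rw [hz n (by simpa [Nat.lt_succ_iff] using hn), smul_zero, smul_zero])
    rw [h1.unique h2, Polynomial.eval_finsetSum]
    refine Finset.sum_congr rfl fun n _ => ?_
    simp
    ring

/-- A function which is a polynomial of bounded degree in each variable is a polynomial. -/
lemma exists_mvPolynomial_of_separately {g : (Fin d → ℂ) → ℂ} {n : ℕ}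
    (h : ∀ (z : Fin d → ℂ) (i : Fin d), ∃ p : Polynomial ℂ, p.degree < n ∧
      ∀ t, g (Function.update z i t) = p.eval t) :
    ∃ p : MvPolynomial (Fin d) ℂ, ∀ z, g z = eval z p := by
  classical
  have key : ∀ s : Finset (Fin d), ∀ w : Fin d → ℂ, ∃ p : MvPolynomial (Fin d) ℂ,
      ∀ z, (∀ i ∉ s, z i = w i) → g z = eval z p := by
    intro s
    induction s using Finset.induction_on with
    | empty =>
      intro w
      refine ⟨C (g w), fun z hz => ?_⟩
      rw [eval_C, funext fun i => hz i (Finset.notMem_empty i)]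
    | insert i s hi ih =>
      intro w
      choose p hp using fun a : ℂ => ih (Function.update w i a)
      -- Lagrange interpolation in the variable `i` at the nodes `0, …, n - 1`: freezing `z i` at a
      -- node leaves one free variable fewer, so the induction hypothesis supplies polynomial
      -- coefficients.
      have hinj : Set.InjOn (fun j : ℕ => (j : ℂ)) (Finset.range n : Finset ℕ) :=
        Nat.cast_injective.injOn
      refine ⟨∑ j ∈ Finset.range n,
        bind₁ (Function.update X i (C (j : ℂ))) (p j) *
          Polynomial.aeval (X i : MvPolynomial (Fin d) ℂ)
            (Lagrange.basis (Finset.range n) (fun j : ℕ => (j : ℂ)) j), fun z hz => ?_⟩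
      obtain ⟨u, hu, hgu⟩ := h z i
      have h1 : g z = u.eval (z i) := by rw [← hgu, Function.update_eq_self]
      have h2 : u = Lagrange.interpolate (Finset.range n) (fun j : ℕ => (j : ℂ))
          (fun j => u.eval (j : ℂ)) :=
        Lagrange.eq_interpolate hinj (by simpa using hu)
      rw [h1, h2, Lagrange.interpolate_apply, Polynomial.eval_finsetSum, map_sum]
      refine Finset.sum_congr rfl fun j _ => ?_
      have h3 : u.eval (j : ℂ) = eval (Function.update z i (j : ℂ)) (p j) := by
        rw [← hgu]
        refine hp _ _ fun l hl => ?_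
        by_cases hli : l = i
        · subst hli; simp
        · rw [Function.update_of_ne hli, Function.update_of_ne hli]
          exact hz l (by simp [hli, hl])
      have h4 : eval z (bind₁ (Function.update X i (C (j : ℂ))) (p j)) =
          eval (Function.update z i (j : ℂ)) (p j) := by
        rw [← coe_aeval_eq_eval, ← coe_aeval_eq_eval]
        change aeval z (bind₁ _ (p j)) = aeval _ (p j)
        rw [aeval_bind₁]
        congr 2
        ext l
        by_cases hli : l = i
        · subst hli; simp
        · simp [Function.update_of_ne hli]
      have h5 : ∀ v : Polynomial ℂ, eval z (Polynomial.aeval (X i : MvPolynomial (Fin d) ℂ) v) =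
          v.eval (z i) := by
        intro v
        have := Polynomial.aeval_algHom_apply (aeval z) (X i : MvPolynomial (Fin d) ℂ) v
        rw [aeval_X] at this
        rw [← Polynomial.coe_aeval_eq_eval, ← coe_aeval_eq_eval]
        exact this.symm
      rw [map_mul, h4, h5, ← h3]
      simp
  obtain ⟨p, hp⟩ := key Finset.univ 0
  exact ⟨p, fun z => hp z fun i hi => absurd (Finset.mem_univ i) hi⟩

/-- A polynomial function which is homogeneous as a function is given by a homogeneous
polynomial. -/
lemma exists_isHomogeneous_of_eval_smul {g : (Fin d → ℂ) → ℂ} {m : ℕ}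
    (hg : ∀ (s : ℂ) z, g (s • z) = s ^ m * g z) (p : MvPolynomial (Fin d) ℂ)
    (hp : ∀ z, g z = eval z p) :
    ∃ q : MvPolynomial (Fin d) ℂ, q.IsHomogeneous m ∧ ∀ z, g z = eval z q := by
  refine ⟨homogeneousComponent m p, homogeneousComponent_isHomogeneous m p, fun z => ?_⟩
  -- Along the line `s ↦ s • z` both expressions are polynomials in `s`; comparing the coefficients
  -- of `s ^ m` isolates the component.
  have h : (Polynomial.C (g z) * Polynomial.X ^ m : Polynomial ℂ) =
      ∑ n ∈ Finset.range (p.totalDegree + 1),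
        Polynomial.C (eval z (homogeneousComponent n p)) * Polynomial.X ^ n := by
    refine Polynomial.funext fun s => ?_
    rw [Polynomial.eval_finsetSum]
    simp only [Polynomial.eval_mul, Polynomial.eval_C, Polynomial.eval_pow, Polynomial.eval_X]
    rw [mul_comm, ← hg, hp]
    conv_lhs => rw [← sum_homogeneousComponent p, map_sum]
    refine Finset.sum_congr rfl fun n _ => ?_
    rw [eval_smul_of_isHomogeneous (homogeneousComponent_isHomogeneous n p), mul_comm]
  have h1 := congrArg (fun u : Polynomial ℂ => u.coeff m) h
  simp only [Polynomial.finsetSum_coeff, Polynomial.coeff_C_mul_X_pow, if_true] at h1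
  rw [h1, Finset.sum_ite_eq]
  split_ifs with h2
  · rfl
  · rw [homogeneousComponent_eq_zero _ _ (by simpa using h2), map_zero]

lemma exists_isHomogeneous_taylorComponent (hf : Differentiable ℂ f) (m : ℕ) :
    ∃ p : MvPolynomial (Fin d) ℂ, p.IsHomogeneous m ∧ ∀ z, taylorComponent f m z = eval z p := by
  obtain ⟨M, hM0, hM⟩ := exists_norm_le_of_norm_le hf 1
  -- Cauchy's inequality at radius `1 / (1 + ‖z‖)`, so that only values of `f` in the unit ball
  -- enter.
  have hgrowth : ∀ z, ‖taylorComponent f m z‖ ≤ M * (1 + ‖z‖) ^ m := by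
    intro z
    have hz : 0 < 1 + ‖z‖ := by positivity
    have := norm_taylorComponent_le hf (z := z) (inv_pos.2 hz) (M := M) (fun ζ hζ => hM _ ?_) m
    · rwa [inv_pow, div_inv_eq_mul] at this
    · rw [norm_smul, hζ, inv_mul_le_iff₀ hz]
      linarith
  obtain ⟨p, hp⟩ := exists_mvPolynomial_of_separately (g := taylorComponent f m) (n := m + 1)
    fun z i => by
      have hline : ∀ t : ℂ, Function.update z i t =
          Function.update z i 0 + t • (Pi.single i 1 : Fin d → ℂ) := by
        intro t
        ext l
        by_cases hl : l = i
        · subst hl; simp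
        · simp only [Pi.add_apply, Pi.smul_apply, Function.update_of_ne hl, Pi.single_eq_of_ne hl,
            smul_zero, add_zero]
      refine exists_polynomial_of_growth (g := fun t => taylorComponent f m (Function.update z i t))
        (K := M) (c := 1 + ‖Function.update z i 0‖) (by
          have e : (fun t : ℂ => taylorComponent f m (Function.update z i t)) = fun t =>
              taylorComponent f m (Function.update z i 0 + t • Pi.single i 1) :=
            funext fun t => congrArg _ (hline t)
          rw [e]
          exact differentiable_taylorComponent_line hf m _ _) fun t => ?_
      refine (hgrowth _).trans (mul_le_mul_of_nonneg_left (pow_le_pow_left₀ (by positivity) ?_ m)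
        hM0)
      rw [add_assoc, hline t]
      refine add_le_add le_rfl ((norm_add_le _ _).trans (add_le_add le_rfl ?_))
      rw [norm_smul, Pi.norm_single, norm_one, mul_one]
  exact exists_isHomogeneous_of_eval_smul (fun s z => taylorComponent_smul hf m s z) p hp

/-! ### Normally convergent series of polynomials and termwise differentiation. -/

/-- A sequence of polynomials whose series converges normally on bounded sets. -/
def LocallySummable (p : ℕ → MvPolynomial (Fin d) ℂ) : Prop :=
  ∀ R : ℝ, ∃ u : ℕ → ℝ, Summable u ∧ ∀ n z, ‖z‖ ≤ R → ‖eval z (p n)‖ ≤ u n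

namespace LocallySummable

variable {p q : ℕ → MvPolynomial (Fin d) ℂ}

lemma summable (hp : LocallySummable p) (z : Fin d → ℂ) : Summable fun n => eval z (p n) := by
  obtain ⟨u, hu, h⟩ := hp ‖z‖
  exact Summable.of_norm_bounded hu fun n => h n z le_rfl

lemma add (hp : LocallySummable p) (hq : LocallySummable q) :
    LocallySummable fun n => p n + q n := by
  intro R
  obtain ⟨u, hu, hu'⟩ := hp R
  obtain ⟨v, hv, hv'⟩ := hq R
  refine ⟨fun n => u n + v n, hu.add hv, fun n z hz => ?_⟩
  rw [map_add]
  exact (norm_add_le _ _).trans (add_le_add (hu' n z hz) (hv' n z hz))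

lemma sum {ι : Type*} (s : Finset ι) {p : ι → ℕ → MvPolynomial (Fin d) ℂ}
    (hp : ∀ i ∈ s, LocallySummable (p i)) : LocallySummable fun n => ∑ i ∈ s, p i n := by
  classical
  induction s using Finset.induction_on with
  | empty => exact fun R => ⟨0, summable_zero, fun n z _ => by simp⟩
  | insert i s hi ih =>
    simp only [Finset.sum_insert hi]
    exact (hp i (by simp)).add (ih fun j hj => hp j (by simp [hj]))

lemma const_mul (hp : LocallySummable p) (w : MvPolynomial (Fin d) ℂ) :
    LocallySummable fun n => w * p n := by
  intro R
  obtain ⟨u, hu, hu'⟩ := hp R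
  obtain ⟨M, hM0, hM⟩ := exists_norm_le_of_norm_le (differentiable_eval w) R
  refine ⟨fun n => M * u n, hu.mul_left M, fun n z hz => ?_⟩
  rw [map_mul, norm_mul]
  exact mul_le_mul (hM z hz) (hu' n z hz) (norm_nonneg _) hM0

lemma neg (hp : LocallySummable p) : LocallySummable fun n => -p n := by
  intro R
  obtain ⟨u, hu, hu'⟩ := hp R
  exact ⟨u, hu, fun n z hz => by rw [map_neg, norm_neg]; exact hu' n z hz⟩

/-- By Cauchy's inequality on discs of radius one, the majorant on a ball of radius larger by one
also majorizes the derivatives. -/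
lemma exists_fderiv_bound (hp : LocallySummable p) (R : ℝ) :
    ∃ u : ℕ → ℝ, Summable u ∧ ∀ n z, ‖z‖ ≤ R → ‖fderiv ℂ (fun z => eval z (p n)) z‖ ≤ u n := by
  obtain ⟨u, hu, hu'⟩ := hp (|R| + 1)
  refine ⟨u, hu, fun n z hz => norm_fderiv_le_of_norm_le (differentiable_eval (p n))
    ((norm_nonneg _).trans (hu' n 0 (by rw [norm_zero]; positivity))) (hu' n)
    (hz.trans (le_abs_self R))⟩

lemma fderiv_eval_single (w : MvPolynomial (Fin d) ℂ) (i : Fin d) (z : Fin d → ℂ) :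
    fderiv ℂ (fun z => eval z w) z (Pi.single i 1) = eval z (pderiv i w) := by
  rw [(hasFDerivAt_eval w z).fderiv]
  simp [Pi.single_apply]

lemma pderiv (hp : LocallySummable p) (i : Fin d) :
    LocallySummable fun n => MvPolynomial.pderiv i (p n) := by
  intro R
  obtain ⟨u, hu, hu'⟩ := hp.exists_fderiv_bound R
  refine ⟨u, hu, fun n z hz => ?_⟩
  rw [← fderiv_eval_single]
  refine (ContinuousLinearMap.le_opNorm _ _).trans ?_
  rw [Pi.norm_single, norm_one, mul_one]
  exact hu' n z hz

lemma hasFDerivAt_tsum (hp : LocallySummable p) (z : Fin d → ℂ) :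
    HasFDerivAt (fun z => ∑' n, eval z (p n)) (∑' n, fderiv ℂ (fun z => eval z (p n)) z) z := by
  obtain ⟨u, hu, hu'⟩ := hp.exists_fderiv_bound (‖z‖ + 1)
  have hz : z ∈ Metric.ball (0 : Fin d → ℂ) (‖z‖ + 1) := by simp
  exact hasFDerivAt_tsum_of_isPreconnected hu Metric.isOpen_ball
    (convex_ball (0 : Fin d → ℂ) (‖z‖ + 1)).isPreconnected
    (fun n x _ => (differentiable_eval (p n) x).hasFDerivAt)
    (fun n x hx => hu' n x (mem_ball_zero_iff.1 hx).le) hz (hp.summable z) hz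

lemma differentiable_tsum (hp : LocallySummable p) :
    Differentiable ℂ fun z => ∑' n, eval z (p n) :=
  fun z => (hp.hasFDerivAt_tsum z).differentiableAt

lemma partialDeriv_tsum (hp : LocallySummable p) (i : Fin d) :
    partialDeriv i (fun z => ∑' n, eval z (p n)) =
      fun z => ∑' n, eval z (MvPolynomial.pderiv i (p n)) := by
  ext z
  obtain ⟨u, hu, hu'⟩ := hp.exists_fderiv_bound ‖z‖
  have hs : Summable fun n => fderiv ℂ (fun z => eval z (p n)) z :=
    Summable.of_norm_bounded hu fun n => hu' n z le_rfl
  rw [partialDeriv, ((hp.hasFDerivAt_tsum z).hasLineDerivAt _).lineDeriv]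
  have := (ContinuousLinearMap.apply ℂ ℂ (Pi.single i 1 : Fin d → ℂ)).map_tsum hs
  simp only [ContinuousLinearMap.apply_apply, fderiv_eval_single] at this
  exact this

lemma polyLaplacian (hp : LocallySummable p) :
    LocallySummable fun n => Fischer.polyLaplacian d (p n) := by
  simp only [polyLaplacian_apply]
  exact LocallySummable.sum _ fun i _ => (hp.pderiv i).pderiv i

lemma laplacian_tsum (hp : LocallySummable p) :
    laplacian (fun z => ∑' n, eval z (p n)) =
      fun z => ∑' n, eval z (Fischer.polyLaplacian d (p n)) := by
  ext z
  simp only [laplacian, hp.partialDeriv_tsum, fun i => (hp.pderiv i).partialDeriv_tsum i,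
    polyLaplacian_apply, map_sum]
  exact (Summable.tsum_finsetSum fun i _ => ((hp.pderiv i).pderiv i).summable z).symm

lemma laplacian_iterate_tsum (hp : LocallySummable p) (k : ℕ) :
    laplacian^[k] (fun z => ∑' n, eval z (p n)) =
      fun z => ∑' n, eval z ((Fischer.polyLaplacian d ^ k) (p n)) := by
  induction k generalizing p with
  | zero => simp
  | succ k ih =>
    rw [Function.iterate_succ_apply, hp.laplacian_tsum, ih hp.polyLaplacian]
    simp only [pow_succ, Module.End.mul_apply]

end LocallySummable

/-! ### Order and exponential growth. -/

variable {g : (Fin d → ℂ) → ℂ}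

lemma norm_toComplex_le (x : EuclideanSpace ℝ (Fin d)) : ‖toComplex x‖ ≤ ‖x‖ := by
  refine (pi_norm_le_iff_of_nonneg (norm_nonneg x)).2 fun i => ?_
  simpa [toComplex] using PiLp.norm_apply_le x i

lemma norm_smul_toComplex_le {ζ : ℂ} {x : EuclideanSpace ℝ (Fin d)} {r : ℝ} (hζ : ‖ζ‖ = r)
    (hx : ‖x‖ = 1) : ‖ζ • toComplex x‖ ≤ r := by
  rw [norm_smul, hζ]
  refine mul_le_of_le_one_right (hζ ▸ norm_nonneg ζ) ?_
  rw [← hx]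
  exact norm_toComplex_le x

lemma maxModulus_nonneg (f : (Fin d → ℂ) → ℂ) (r : ℝ) : 0 ≤ maxModulus f r := by
  refine Real.sSup_nonneg ?_
  rintro y ⟨ζ, θ, -, -, rfl⟩
  exact norm_nonneg _

lemma norm_le_maxModulus (hf : Differentiable ℂ f) {ζ : ℂ} {θ : EuclideanSpace ℝ (Fin d)}
    (hθ : ‖θ‖ = 1) : ‖f (ζ • toComplex θ)‖ ≤ maxModulus f ‖ζ‖ := by
  obtain ⟨M, -, hM⟩ := exists_norm_le_of_norm_le hf ‖ζ‖
  refine le_csSup ⟨M, ?_⟩ ⟨ζ, θ, rfl, hθ, rfl⟩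
  rintro y ⟨ξ, η, hξ, hη, rfl⟩
  exact hM _ (norm_smul_toComplex_le hξ hη)

lemma maxModulus_le {r M : ℝ} (hM0 : 0 ≤ M) (hM : ∀ z, ‖z‖ ≤ r → ‖f z‖ ≤ M) :
    maxModulus f r ≤ M := by
  refine Real.sSup_le ?_ hM0
  rintro y ⟨ξ, η, hξ, hη, rfl⟩
  exact hM _ (norm_smul_toComplex_le hξ hη)

lemma norm_le_maxModulus_of_le (hf : Differentiable ℂ f) {ζ : ℂ} {r : ℝ} (hr : 0 < r)
    (hζ : ‖ζ‖ ≤ r) {θ : EuclideanSpace ℝ (Fin d)} (hθ : ‖θ‖ = 1) :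
    ‖f (ζ • toComplex θ)‖ ≤ maxModulus f r := by
  refine Complex.norm_le_of_forall_mem_frontier_norm_le (U := Metric.ball (0 : ℂ) r)
    Metric.isBounded_ball (differentiable_comp_smul hf (toComplex θ)).diffContOnCl ?_ ?_
  · intro ξ hξ
    rw [frontier_ball _ hr.ne', mem_sphere_zero_iff_norm] at hξ
    rw [← hξ]
    exact norm_le_maxModulus hf hθ
  · rw [closure_ball _ hr.ne']
    simpa using hζ

lemma eventually_maxModulus_le_exp {σ : ℝ} (h : order f < ENNReal.ofReal σ) :
    ∀ᶠ r in atTop, maxModulus f r ≤ Real.exp (r ^ σ) := by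
  have hlt := eventually_lt_of_limsup_lt h
  filter_upwards [hlt, eventually_gt_atTop 1] with r hr hr1
  have hlog : 0 < Real.log r := Real.log_pos hr1
  have hr0 : 0 < r := by linarith
  have h1 := (ENNReal.ofReal_lt_ofReal_iff' .. |>.1 hr).1
  rw [div_lt_iff₀ hlog, ← Real.log_rpow hr0] at h1
  have hp : 0 < r ^ σ := Real.rpow_pos_of_pos hr0 σ
  have h2 : Real.log (maxModulus f r) ≤ r ^ σ := by
    by_cases h3 : 0 < Real.log (maxModulus f r)
    · exact ((Real.log_lt_log_iff h3 hp).1 h1).le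
    · linarith
  rcases (maxModulus_nonneg f r).eq_or_lt with h4 | h4
  · rw [← h4]; exact (Real.exp_pos _).le
  · rwa [← Real.log_le_iff_le_exp h4]

lemma order_le_of_eventually_le_exp (hf : Differentiable ℂ f) {σ : ℝ} (hσ : 0 < σ)
    (h : ∀ᶠ r in atTop, maxModulus f r ≤ Real.exp (r ^ σ)) : order f ≤ ENNReal.ofReal σ := by
  refine limsup_le_of_le (by isBoundedDefault) ?_
  -- A nonzero value of `f` on the cone of the points `ζ • toComplex θ` keeps the maximum modulus
  -- away from `0`. Otherwise it vanishes identically, and the convention `Real.log 0 = 0` gives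
  -- order `0`.
  by_cases h0 : ∃ (ζ : ℂ) (θ : EuclideanSpace ℝ (Fin d)), ‖θ‖ = 1 ∧ f (ζ • toComplex θ) ≠ 0
  · obtain ⟨ζ, θ, hθ, hne⟩ := h0
    set c := ‖f (ζ • toComplex θ)‖ with hc
    have hc0 : 0 < c := norm_pos_iff.2 hne
    have hbig := (tendsto_rpow_atTop hσ).eventually_ge_atTop |Real.log c|
    filter_upwards [h, eventually_gt_atTop 1, eventually_ge_atTop ‖ζ‖, hbig] with r hr hr1 hζ hb
    have hr0 : 0 < r := by linarith
    have hlog : 0 < Real.log r := Real.log_pos hr1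
    have hcM : c ≤ maxModulus f r := norm_le_maxModulus_of_le hf hr0 hζ hθ
    have hM : 0 < maxModulus f r := hc0.trans_le hcM
    refine ENNReal.ofReal_le_ofReal ?_
    rw [div_le_iff₀ hlog, ← Real.log_rpow hr0]
    by_cases hL : Real.log (maxModulus f r) = 0
    · rw [hL, Real.log_zero]
      exact Real.log_nonneg (Real.one_le_rpow hr1.le hσ.le)
    -- `log (maxModulus f r)` may be negative and `Real.log` is even, so its absolute value has to
    -- be bounded; the lower bound `c` takes care of the negative side.
    · rw [← Real.log_abs]
      refine Real.log_le_log (abs_pos.2 hL) (abs_le.2 ⟨?_, ?_⟩)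
      · have := Real.log_le_log hc0 hcM
        have := neg_abs_le (Real.log c)
        linarith
      · exact (Real.log_le_iff_le_exp hM).2 hr
  · push Not at h0
    refine .of_forall fun r => ?_
    have hM : maxModulus f r = 0 := by
      refine le_antisymm (Real.sSup_le ?_ le_rfl) (maxModulus_nonneg f r)
      rintro y ⟨ζ, θ, -, hθ, rfl⟩
      rw [h0 ζ θ hθ, norm_zero]
    rw [hM]
    simp

/-- `|g z| ≤ exp (R ^ σ)` for `|z| ≤ R` and all large `R`. -/
def HasGrowth (g : (Fin d → ℂ) → ℂ) (σ : ℝ) : Prop :=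
  ∀ᶠ R in atTop, ∀ z, ‖z‖ ≤ R → ‖g z‖ ≤ Real.exp (R ^ σ)

lemma eventually_mul_rpow_le (c : ℝ) {σ τ : ℝ} (h : σ < τ) :
    ∀ᶠ R : ℝ in atTop, c * R ^ σ ≤ R ^ τ := by
  filter_upwards [(tendsto_rpow_atTop (sub_pos.2 h)).eventually_ge_atTop c,
    eventually_gt_atTop 0] with R hR hR0
  calc c * R ^ σ ≤ R ^ (τ - σ) * R ^ σ :=
        mul_le_mul_of_nonneg_right hR (Real.rpow_nonneg hR0.le _)
    _ = R ^ τ := by rw [← Real.rpow_add hR0, sub_add_cancel]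

lemma HasGrowth.mul {σ τ : ℝ} (hf : HasGrowth f σ) (hg : HasGrowth g σ) (h : σ < τ) :
    HasGrowth (fun z => f z * g z) τ := by
  filter_upwards [hf, hg, eventually_mul_rpow_le 2 h] with R h1 h2 h3 z hz
  rw [norm_mul]
  refine (mul_le_mul (h1 z hz) (h2 z hz) (norm_nonneg _) (Real.exp_pos _).le).trans ?_
  rw [← Real.exp_add]
  exact Real.exp_le_exp.2 (by linarith)

lemma HasGrowth.add {σ τ : ℝ} (hσ : 0 < σ) (hf : HasGrowth f σ) (hg : HasGrowth g σ) (h : σ < τ) :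
    HasGrowth (fun z => f z + g z) τ := by
  filter_upwards [hf, hg, eventually_mul_rpow_le 2 h, eventually_ge_atTop 1] with R h1 h2 h3 hR z hz
  refine (norm_add_le _ _).trans ((add_le_add (h1 z hz) (h2 z hz)).trans ?_)
  have h4 : 1 ≤ R ^ σ := Real.one_le_rpow hR hσ.le
  have h5 : 2 ≤ Real.exp (R ^ σ) := by
    have := Real.add_one_le_exp (R ^ σ)
    linarith
  calc Real.exp (R ^ σ) + Real.exp (R ^ σ) = 2 * Real.exp (R ^ σ) := by ring
    _ ≤ Real.exp (R ^ σ) * Real.exp (R ^ σ) :=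
      mul_le_mul_of_nonneg_right h5 (Real.exp_pos _).le
    _ = Real.exp (2 * R ^ σ) := by rw [← Real.exp_add, two_mul]
    _ ≤ _ := Real.exp_le_exp.2 h3

lemma hasGrowth_eval (p : MvPolynomial (Fin d) ℂ) {σ : ℝ} (hσ : 0 < σ) :
    HasGrowth (fun z => eval z p) σ := by
  induction p using MvPolynomial.induction_on generalizing σ with
  | C a =>
    filter_upwards [(tendsto_rpow_atTop hσ).eventually_ge_atTop ‖a‖] with R hR z _
    rw [eval_C]
    have := Real.add_one_le_exp (R ^ σ)
    linarith
  | add p q hp hq =>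
    simp only [map_add]
    exact (hp (half_pos hσ)).add (half_pos hσ) (hq (half_pos hσ)) (half_lt_self hσ)
  | mul_X p i hp =>
    simp only [map_mul, eval_X]
    refine (hp (half_pos hσ)).mul ?_ (half_lt_self hσ)
    filter_upwards [(isLittleO_log_rpow_atTop (half_pos hσ)).bound one_pos,
      eventually_gt_atTop 1] with R hR hR1 z hz
    have hR0 : 0 < R := by linarith
    refine ((norm_le_pi_norm z i).trans hz).trans ?_
    rw [← Real.log_le_iff_le_exp hR0]
    rw [one_mul, Real.norm_of_nonneg (Real.log_nonneg hR1.le),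
      Real.norm_of_nonneg (Real.rpow_nonneg hR0.le _)] at hR
    exact hR

lemma order_le_of_hasGrowth (hf : Differentiable ℂ f) {s : ℝ} (hs : 0 ≤ s)
    (h : ∀ σ, s < σ → HasGrowth f σ) : order f ≤ ENNReal.ofReal s := by
  have h1 : ∀ σ, s < σ → order f ≤ ENNReal.ofReal σ := fun σ hσ =>
    order_le_of_eventually_le_exp hf (hs.trans_lt hσ) ((h σ hσ).mono fun R hR =>
      maxModulus_le (Real.exp_pos _).le hR)
  have ht : Tendsto ENNReal.ofReal (nhdsWithin s (Set.Ioi s)) (nhds (ENNReal.ofReal s)) :=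
    (ENNReal.continuous_ofReal.tendsto s).mono_left nhdsWithin_le_nhds
  refine ge_of_tendsto ht ?_
  filter_upwards [self_mem_nhdsWithin] with σ hσ using h1 σ hσ

/-! ### Summing the estimates. -/

section Majorant

variable {A B D a b : ℝ}

/-- The base of the power splits into `A R X^(-b)` and `A X^(a - b)`. The first is at most `1/4`
once `m ≥ (4AR)^(1/b)`, the second once `m ≥ m₀`, so all later terms are dominated by a geometric
series. For the earlier ones the base is at most `1 + A (R + 1)`. -/
lemma exists_majorant (hA : 0 ≤ A) (hB : 0 ≤ B) (hD : 1 ≤ D) (hab : a < b) (hb : 0 < b) :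
    ∃ m₀ : ℕ, ∀ (R : ℝ) (m : ℕ), 0 ≤ R →
      B * (A * ((R + ((m : ℝ) + D) ^ a) * ((m : ℝ) + D) ^ (-b))) ^ m ≤
        B * (1 / 2) ^ m + if m < m₀ + ⌈(4 * A * R) ^ (1 / b)⌉₊ then
          B * (1 + A * (R + 1)) ^ (m₀ + ⌈(4 * A * R) ^ (1 / b)⌉₊) else 0 := by
  have hlim : Tendsto (fun m : ℕ => A * ((m : ℝ) + D) ^ (-(b - a))) atTop (nhds (A * 0)) :=
    ((tendsto_rpow_neg_atTop (sub_pos.2 hab)).comp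
      (tendsto_atTop_add_const_right _ D tendsto_natCast_atTop_atTop)).const_mul A
  rw [mul_zero] at hlim
  obtain ⟨m₀, hm₀⟩ := eventually_atTop.1
    (hlim.eventually_le_const (show (0 : ℝ) < 1 / 4 by norm_num))
  refine ⟨m₀, fun R m hR => ?_⟩
  set X : ℝ := (m : ℝ) + D with hX
  have hX1 : 1 ≤ X := by
    have : (0 : ℝ) ≤ m := Nat.cast_nonneg m
    linarith
  have hX0 : 0 < X := by linarith
  have hXb : 0 ≤ X ^ (-b) := Real.rpow_nonneg hX0.le _
  have hXab : X ^ a * X ^ (-b) = X ^ (-(b - a)) := by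
    rw [← Real.rpow_add hX0]
    ring_nf
  have hY0 : 0 ≤ A * ((R + X ^ a) * X ^ (-b)) := by
    have := Real.rpow_nonneg hX0.le a
    positivity
  set N := m₀ + ⌈(4 * A * R) ^ (1 / b)⌉₊ with hN
  split_ifs with hm
  · have h1 : A * ((R + X ^ a) * X ^ (-b)) ≤ 1 + A * (R + 1) := by
      have e1 : X ^ (-b) ≤ 1 := Real.rpow_le_one_of_one_le_of_nonpos hX1 (by linarith)
      have e2 : X ^ a * X ^ (-b) ≤ 1 := by
        rw [hXab]
        exact Real.rpow_le_one_of_one_le_of_nonpos hX1 (by linarith)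
      have e3 : (R + X ^ a) * X ^ (-b) ≤ R + 1 := by
        rw [add_mul]
        exact add_le_add (mul_le_of_le_one_right hR e1) e2
      have := mul_le_mul_of_nonneg_left e3 hA
      linarith
    have h2 : 1 ≤ 1 + A * (R + 1) := by
      have : 0 ≤ A * (R + 1) := by positivity
      linarith
    have h3 := (pow_le_pow_left₀ hY0 h1 m).trans (pow_le_pow_right₀ h2 hm.le)
    have h4 := mul_le_mul_of_nonneg_left h3 hB
    have : 0 ≤ B * (1 / 2 : ℝ) ^ m := by positivity
    linarith
  · rw [add_zero]
    push Not at hm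
    refine mul_le_mul_of_nonneg_left (pow_le_pow_left₀ hY0 ?_ m) hB
    have e1 : A * X ^ (-(b - a)) ≤ 1 / 4 := hm₀ m (by omega)
    have e2 : A * R * X ^ (-b) ≤ 1 / 4 := by
      have h1 : (4 * A * R) ^ (1 / b) ≤ X := by
        have h5 : (⌈(4 * A * R) ^ (1 / b)⌉₊ : ℝ) ≤ m := by exact_mod_cast (by omega)
        have := Nat.le_ceil ((4 * A * R) ^ (1 / b))
        linarith
      have h0 : 0 ≤ 4 * A * R := by positivity
      have h2 : 4 * A * R ≤ X ^ b := by
        have := Real.rpow_le_rpow (Real.rpow_nonneg h0 _) h1 hb.le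
        rwa [← Real.rpow_mul h0, one_div_mul_cancel hb.ne', Real.rpow_one] at this
      rw [Real.rpow_neg hX0.le, ← div_eq_mul_inv, div_le_iff₀ (Real.rpow_pos_of_pos hX0 _)]
      linarith
    calc A * ((R + X ^ a) * X ^ (-b)) = A * R * X ^ (-b) + A * (X ^ a * X ^ (-b)) := by ring
      _ ≤ 1 / 4 + 1 / 4 := by rw [hXab]; exact add_le_add e2 e1
      _ = 1 / 2 := by norm_num

lemma hasSum_majorant (B C : ℝ) (N : ℕ) :
    HasSum (fun m : ℕ => B * (1 / 2 : ℝ) ^ m + if m < N then C else 0) (B * 2 + N * C) := by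
  refine (hasSum_geometric_two.mul_left B).add ?_
  have := hasSum_sum_of_ne_finset_zero (L := SummationFilter.unconditional ℕ)
    (s := Finset.range N) (f := fun m => if m < N then C else 0)
    (fun m hm => if_neg (by simpa using hm))
  rwa [Finset.sum_congr rfl (fun m hm => if_pos (Finset.mem_range.1 hm)), Finset.sum_const,
    Finset.card_range, nsmul_eq_mul] at this

/-- There are `N = O(R^σ)` exceptional terms, each of size `exp (N log O(R))`. Bounding the
logarithm by `R^ε` with `ε = (τ - σ) / 2` leaves the exponent `σ + ε < τ`. -/
lemma eventually_majorant_le (hA : 0 ≤ A) (hB : 0 ≤ B) {σ τ : ℝ} (hσ : 0 < σ) (hτ : σ < τ)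
    (m₀ : ℕ) :
    ∀ᶠ R : ℝ in atTop, B * 2 + ((m₀ + ⌈(4 * A * R) ^ σ⌉₊ : ℕ) : ℝ) *
      (B * (1 + A * (R + 1)) ^ (m₀ + ⌈(4 * A * R) ^ σ⌉₊)) ≤ Real.exp (R ^ τ) := by
  set ε : ℝ := (τ - σ) / 2 with hε
  have hε0 : 0 < ε := by rw [hε]; linarith
  set c₁ : ℝ := m₀ + 1 + (4 * A) ^ σ with hc₁
  have hc₁0 : 0 ≤ c₁ := by positivity
  set c₂ : ℝ := (2 + 4 * A) ^ ε / ε with hc₂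
  have hc₂0 : 0 ≤ c₂ := by positivity
  filter_upwards [eventually_ge_atTop 1, eventually_mul_rpow_le (2 * B + c₁ * c₂)
    (show σ + ε < τ by rw [hε]; linarith)] with R hR hfin
  have hR0 : 0 < R := by linarith
  set N := m₀ + ⌈(4 * A * R) ^ σ⌉₊ with hN
  set Z : ℝ := 1 + A * (R + 1) with hZ
  have hAR : 0 ≤ A * (R + 1) := by positivity
  have hZ1 : 1 ≤ Z := by linarith
  have hRσ : 1 ≤ R ^ σ := Real.one_le_rpow hR hσ.le
  have hNle : (N : ℝ) ≤ c₁ * R ^ σ := by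
    have h1 : (⌈(4 * A * R) ^ σ⌉₊ : ℝ) ≤ (4 * A) ^ σ * R ^ σ + 1 := by
      rw [← Real.mul_rpow (by positivity) hR0.le]
      exact (Nat.ceil_lt_add_one (by positivity)).le
    rw [hN, Nat.cast_add, hc₁, add_mul]
    have h2 : (0 : ℝ) ≤ m₀ := Nat.cast_nonneg _
    nlinarith
  have hlog : Real.log (2 * Z) ≤ c₂ * R ^ ε := by
    have h1 : 2 * Z ≤ (2 + 4 * A) * R := by rw [hZ]; nlinarith
    have h2 := Real.log_le_rpow_div (show 0 ≤ 2 * Z by linarith) hε0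
    refine h2.trans ?_
    rw [hc₂, div_mul_eq_mul_div, ← Real.mul_rpow (by positivity) hR0.le]
    exact div_le_div_of_nonneg_right (Real.rpow_le_rpow (by linarith) h1 hε0.le) hε0.le
  have h2N : ((N : ℝ) + 1) ≤ 2 ^ N := by exact_mod_cast Nat.lt_two_pow_self (n := N)
  have hZN : 1 ≤ Z ^ N := one_le_pow₀ hZ1
  calc B * 2 + (N : ℝ) * (B * Z ^ N) ≤ 2 * B * (((N : ℝ) + 1) * Z ^ N) := by
        have e1 : B * 1 ≤ B * Z ^ N := mul_le_mul_of_nonneg_left hZN hB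
        have e2 : 0 ≤ (N : ℝ) * (B * Z ^ N) := by positivity
        nlinarith
    _ ≤ 2 * B * (2 ^ N * Z ^ N) := by gcongr
    _ = 2 * B * (2 * Z) ^ N := by rw [mul_pow]
    _ = 2 * B * Real.exp (N * Real.log (2 * Z)) := by
        rw [Real.exp_nat_mul, Real.exp_log (by linarith)]
    _ ≤ Real.exp (2 * B) * Real.exp (N * Real.log (2 * Z)) := by
        refine mul_le_mul_of_nonneg_right ?_ (Real.exp_pos _).le
        have := Real.add_one_le_exp (2 * B)
        linarith
    _ = Real.exp (2 * B + N * Real.log (2 * Z)) := (Real.exp_add _ _).symm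
    _ ≤ _ := by
        refine Real.exp_le_exp.2 (le_trans ?_ hfin)
        have e1 : (N : ℝ) * Real.log (2 * Z) ≤ (c₁ * R ^ σ) * (c₂ * R ^ ε) :=
          mul_le_mul hNle hlog (Real.log_nonneg (by linarith)) (by positivity)
        have e2 : R ^ (σ + ε) = R ^ σ * R ^ ε := Real.rpow_add hR0 _ _
        have e3 : 1 ≤ R ^ (σ + ε) := Real.one_le_rpow hR (by linarith)
        have e4 : 2 * B * 1 ≤ 2 * B * R ^ (σ + ε) := by gcongr
        calc 2 * B + (N : ℝ) * Real.log (2 * Z) ≤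
              2 * B * R ^ (σ + ε) + (c₁ * R ^ σ) * (c₂ * R ^ ε) := by linarith
          _ = _ := by rw [e2]; ring

lemma locallySummable_and_hasGrowth (hA : 0 ≤ A) (hB : 0 ≤ B) (hD : 1 ≤ D) (hab : a < b)
    (hb : 0 < b) {p : ℕ → MvPolynomial (Fin d) ℂ}
    (h : ∀ (m : ℕ) (R : ℝ), 0 ≤ R → ∀ z, ‖z‖ ≤ R → ‖eval z (p m)‖ ≤
      B * (A * ((R + ((m : ℝ) + D) ^ a) * ((m : ℝ) + D) ^ (-b))) ^ m) :
    LocallySummable p ∧ ∀ τ, 1 / b < τ → HasGrowth (fun z => ∑' m, eval z (p m)) τ := by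
  obtain ⟨m₀, hm₀⟩ := exists_majorant hA hB hD hab hb
  refine ⟨fun R => ⟨_, (hasSum_majorant B (B * (1 + A * (|R| + 1)) ^
      (m₀ + ⌈(4 * A * |R|) ^ (1 / b)⌉₊)) _).summable, fun m z hz =>
      (h m |R| (abs_nonneg R) z (hz.trans (le_abs_self R))).trans (hm₀ _ m (abs_nonneg R))⟩,
    fun τ hτ => ?_⟩
  filter_upwards [eventually_ge_atTop 0, eventually_majorant_le hA hB (one_div_pos.2 hb) hτ m₀]
    with R hR hle z hz
  exact (tsum_of_norm_bounded (hasSum_majorant B _ _)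
    fun m => (h m R hR z hz).trans (hm₀ R m hR)).trans hle

end Majorant

/-- Cauchy's inequality at radius `X ^ (1 / σ)`, chosen so that the growth bound there is exactly
`exp X`. -/
lemma sphereNorm_taylorComponent_le {f : (Fin d → ℂ) → ℂ} (hf : Differentiable ℂ f)
    {F : ℕ → MvPolynomial (Fin d) ℂ} (hF : ∀ m z, taylorComponent f m z = eval z (F m)) {σ r₀ : ℝ}
    (hσ : 0 < σ) (hr₀ : ∀ r, r₀ ≤ r → maxModulus f r ≤ Real.exp (r ^ σ)) {X : ℝ} (hX : 0 < X)
    (hXr : r₀ ≤ X ^ (1 / σ)) (m : ℕ) :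
    sphereNorm (F m) ≤
      Real.exp X * (X ^ (-(1 / σ))) ^ m * √((sphereMeasure d).real Set.univ) := by
  have hXb : 0 < X ^ (1 / σ) := Real.rpow_pos_of_pos hX _
  refine sphereNorm_le_of_forall_le
    (mul_nonneg (Real.exp_pos _).le (pow_nonneg (Real.rpow_nonneg hX.le _) _)) fun x hx => ?_
  rw [← hF, Real.rpow_neg hX.le, inv_pow, ← div_eq_mul_inv]
  refine norm_taylorComponent_le hf hXb (fun ζ hζ => ?_) m
  refine (norm_le_maxModulus hf hx).trans ?_
  rw [hζ]
  refine (hr₀ _ hXr).trans (le_of_eq ?_)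
  rw [← Real.rpow_mul hX.le, one_div_mul_cancel hσ.ne', Real.rpow_one]

/-- With `X = m + E`, the factor `exp X` is `e^m * exp E`: the first part goes into `A` and the
second into `B`. The shift `E` makes the growth bound of `f` available for every `m`. -/
lemma locallySummable_and_hasGrowth_of_sphereNorm {f : (Fin d → ℂ) → ℂ} (hf : Differentiable ℂ f)
    {F : ℕ → MvPolynomial (Fin d) ℂ} (hF : ∀ m z, taylorComponent f m z = eval z (F m)) {σ : ℝ}
    (hσ : 0 < σ) (horder : order f < ENNReal.ofReal σ) {a A B D : ℝ} (ha : a < 1 / σ)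
    (hA : 0 ≤ A) (hB : 0 ≤ B) {p : ℕ → MvPolynomial (Fin d) ℂ}
    (h : ∀ (m : ℕ) (R X : ℝ), 0 ≤ R → 1 ≤ X → m + D ≤ X → ∀ z : Fin d → ℂ, ‖z‖ ≤ R →
      ‖eval z (p m)‖ ≤ B * (A * (R + X ^ a)) ^ m * sphereNorm (F m)) :
    LocallySummable p ∧ ∀ τ, σ < τ → HasGrowth (fun z => ∑' m, eval z (p m)) τ := by
  obtain ⟨r₀, hr₀⟩ := eventually_atTop.1 (eventually_maxModulus_le_exp horder)
  have hb : 0 < 1 / σ := one_div_pos.2 hσ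
  obtain ⟨X₀, hX₀⟩ := eventually_atTop.1 ((tendsto_rpow_atTop hb).eventually_ge_atTop r₀)
  set E : ℝ := max (max 1 D) X₀
  have hE1 : 1 ≤ E := (le_max_left _ _).trans (le_max_left _ _)
  have hED : D ≤ E := (le_max_right _ _).trans (le_max_left _ _)
  have hEX : X₀ ≤ E := le_max_right _ _
  set S := √((sphereMeasure d).real Set.univ)
  have hS : 0 ≤ S := Real.sqrt_nonneg _
  have key := locallySummable_and_hasGrowth (A := A * Real.exp 1) (B := B * (Real.exp E * S))
    (D := E) (a := a) (b := 1 / σ) (by positivity) (by positivity) hE1 ha hb (p := p)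
    fun m R hR z hz => by
      have hm : (0 : ℝ) ≤ m := Nat.cast_nonneg m
      set X : ℝ := m + E with hX
      have hX1 : 1 ≤ X := by linarith
      have hX0 : 0 < X := by linarith
      have hXa : 0 ≤ X ^ a := Real.rpow_nonneg hX0.le a
      refine (h m R X hR hX1 (by linarith) z hz).trans ?_
      refine (mul_le_mul_of_nonneg_left (sphereNorm_taylorComponent_le hf hF hσ hr₀ hX0
        (hX₀ X (by linarith)) m) (by positivity)).trans (le_of_eq ?_)
      have e : Real.exp X = Real.exp 1 ^ m * Real.exp E := by
        rw [hX, Real.exp_add, ← Real.exp_nat_mul, mul_one]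
      rw [e]
      simp only [mul_pow]
      ring
  rwa [one_div_one_div] at key

end Fischer

/-! ### Assembly of the quotient and the remainder. -/

open Fischer in
theorem mainTheorem1 (d : ℕ) (hd : 1 ≤ d) (k : ℕ) (hk : 0 < k)
    (P2k : MvPolynomial (Fin d) ℂ) (hP2k : P2k.IsHomogeneous (2 * k))
    (C D α : ℝ) (hC : 0 < C) (hD : 0 < D) (hα : 0 ≤ α)
    (hineq : ∀ (m : ℕ) (fm : MvPolynomial (Fin d) ℂ), fm.IsHomogeneous m →
      Fischer.sphereInner (P2k * fm) fm ≥
        ((1 / (C * ((m : ℝ) + D) ^ α) : ℝ) : ℂ) * Fischer.sphereInner fm fm)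
    (β : ℕ) (hβ : β < 2 * k)
    (P : ℕ → MvPolynomial (Fin d) ℂ) (hP : ∀ j ≤ β, (P j).IsHomogeneous j)
    (f : (Fin d → ℂ) → ℂ) (hf : Differentiable ℂ f)
    (horder : Fischer.order f < ENNReal.ofReal (2 * (k : ℝ) - (β : ℝ)) / ENNReal.ofReal α) :
    ∃ q r : (Fin d → ℂ) → ℂ,
      Differentiable ℂ q ∧ Differentiable ℂ r ∧
      Fischer.order q ≤ Fischer.order f ∧ Fischer.order r ≤ Fischer.order f ∧
      (∀ z : Fin d → ℂ,
        f z = MvPolynomial.eval z (P2k - ∑ j ∈ Finset.range (β + 1), P j) * q z + r z) ∧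
      (∀ z : Fin d → ℂ, (Fischer.laplacian^[k] r) z = 0) := by
  set κ : ℝ := 2 * (k : ℝ) - (β : ℝ) with hκ
  have hκ0 : 0 < κ := by
    have : (β : ℝ) < 2 * k := by exact_mod_cast hβ
    linarith
  set ρ : ℝ := (order f).toReal
  have hρ : ENNReal.ofReal ρ = order f := ENNReal.ofReal_toReal horder.ne_top
  have hρ0 : 0 ≤ ρ := ENNReal.toReal_nonneg
  -- The product form of the hypothesis on the order also covers `α = 0`.
  have hρα : ρ * α < κ := by
    rcases hα.eq_or_lt with rfl | hα0
    · simpa using hκ0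
    · rw [← hρ, ← ENNReal.ofReal_div_of_pos hα0,
        ENNReal.ofReal_lt_ofReal_iff (div_pos hκ0 hα0), lt_div_iff₀ hα0] at horder
      exact horder
  have hσ : ∀ τ, ρ < τ → ∃ σ, ρ < σ ∧ σ < τ ∧ σ * α < κ := by
    intro τ hτ
    have h1 : ∀ᶠ σ in nhds ρ, σ < τ ∧ σ * α < κ :=
      (eventually_lt_nhds hτ).and
        (((continuous_mul_const α).tendsto ρ).eventually_lt_const hρα)
    obtain ⟨σ, h2, h3⟩ := ((h1.filter_mono nhdsWithin_le_nhds).and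
      (self_mem_nhdsWithin (a := ρ) (s := Set.Ioi ρ))).exists
    exact ⟨σ, h3, h2⟩
  obtain ⟨A, B, hA, hB, hq⟩ := exists_quotient hd hP2k hC hD hα
    (fun m g hg => hineq m g hg) hβ hP
  choose F hFh hF using exists_isHomogeneous_taylorComponent hf
  choose q hqr hqb using fun m => hq m (F m) (hFh m)
  set W := P2k - ∑ j ∈ Finset.range (β + 1), P j with hW
  have hexp : ∀ σ, ρ < σ → σ * α < κ → α / κ < 1 / σ ∧ order f < ENNReal.ofReal σ ∧ 0 < σ := by
    intro σ h1 h2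
    have h3 : 0 < σ := hρ0.trans_lt h1
    refine ⟨?_, ?_, h3⟩
    · rw [div_lt_div_iff₀ hκ0 h3]
      linarith
    · rw [← hρ]
      exact (ENNReal.ofReal_lt_ofReal_iff h3).2 h1
  have hqall : ∀ σ, ρ < σ → σ * α < κ → LocallySummable q ∧
      ∀ τ, σ < τ → HasGrowth (fun z => ∑' m, MvPolynomial.eval z (q m)) τ := by
    intro σ h1 h2
    obtain ⟨h3, h4, h5⟩ := hexp σ h1 h2
    exact locallySummable_and_hasGrowth_of_sphereNorm hf hF h5 h4 h3 hA.le hB.le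
      (D := D) fun m R X hR hX hmX z hz => hqb m R X hR hX hmX z hz
  -- `maxModulus` controls `f` only on complex multiples of real directions. Growth of `f` on full
  -- balls of `ℂ^d` is recovered by summing its Taylor components with the same majorant; here the
  -- term `X ^ (α / κ)` is mere padding.
  have hFall : ∀ σ, ρ < σ → σ * α < κ → LocallySummable F ∧
      ∀ τ, σ < τ → HasGrowth (fun z => ∑' m, MvPolynomial.eval z (F m)) τ := by
    intro σ h1 h2
    obtain ⟨h3, h4, h5⟩ := hexp σ h1 h2
    refine locallySummable_and_hasGrowth_of_sphereNorm hf hF h5 h4 h3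
      (A := (d + 2) ^ 2) (B := (√((sphereMeasure d).real Set.univ))⁻¹) (by positivity)
      (by positivity) (D := D) fun m R X hR hX hmX z hz => ?_
    refine (norm_eval_le_sphereNorm hd m (F m) (hFh m) z).trans
      (mul_le_mul_of_nonneg_right ?_ (sphereNorm_nonneg _))
    have hX0 : 0 ≤ X ^ (α / κ) := Real.rpow_nonneg (by linarith) _
    rw [mul_pow, ← mul_assoc]
    gcongr
    linarith
  obtain ⟨σ₀, h1, -, h2⟩ := hσ (ρ + 1) (by linarith)
  have hqs := (hqall σ₀ h1 h2).1
  have hFs := (hFall σ₀ h1 h2).1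
  have hrs : LocallySummable fun m => F m - W * q m := by
    simpa only [sub_eq_add_neg] using hFs.add (hqs.const_mul W).neg
  have hfF : ∀ z, f z = ∑' m, MvPolynomial.eval z (F m) := fun z => by
    rw [← (hasSum_taylorComponent hf z).tsum_eq]
    exact tsum_congr fun m => hF m z
  have hr : ∀ z, ∑' m, MvPolynomial.eval z (F m - W * q m) =
      f z + MvPolynomial.eval z (-W) * ∑' m, MvPolynomial.eval z (q m) := fun z => by
    rw [hfF, ← tsum_mul_left, ← (hFs.summable z).tsum_add ((hqs.summable z).mul_left _)]
    exact tsum_congr fun m => by simp [sub_eq_add_neg]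
  have hqg : ∀ τ, ρ < τ → HasGrowth (fun z => ∑' m, MvPolynomial.eval z (q m)) τ := by
    intro τ hτ
    obtain ⟨σ, h3, h4, h5⟩ := hσ τ hτ
    exact (hqall σ h3 h5).2 τ h4
  have hfg : ∀ τ, ρ < τ → HasGrowth f τ := by
    intro τ hτ
    obtain ⟨σ, h3, h4, h5⟩ := hσ τ hτ
    rw [funext hfF]
    exact (hFall σ h3 h5).2 τ h4
  -- Multiplication by `W` and addition of `f` each cost an arbitrarily small increase of the
  -- exponent, hence the chain `ρ < σ₁ < σ₂ < τ`.
  have hrg : ∀ τ, ρ < τ → HasGrowth (fun z => ∑' m, MvPolynomial.eval z (F m - W * q m)) τ := by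
    intro τ hτ
    obtain ⟨σ₂, h3, h4, -⟩ := hσ τ hτ
    obtain ⟨σ₁, h5, h6, -⟩ := hσ σ₂ h3
    rw [funext hr]
    exact (hfg σ₂ h3).add (hρ0.trans_lt h3)
      ((hasGrowth_eval (-W) (hρ0.trans_lt h5)).mul (hqg σ₁ h5) h6) h4
  refine ⟨fun z => ∑' m, MvPolynomial.eval z (q m),
    fun z => ∑' m, MvPolynomial.eval z (F m - W * q m), hqs.differentiable_tsum,
    hrs.differentiable_tsum, ?_, ?_, fun z => ?_, fun z => ?_⟩
  · rw [← hρ]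
    exact order_le_of_hasGrowth hqs.differentiable_tsum hρ0 hqg
  · rw [← hρ]
    exact order_le_of_hasGrowth hrs.differentiable_tsum hρ0 hrg
  · simp only [hr z, map_neg]
    ring
  · rw [hrs.laplacian_iterate_tsum]
    simp only [hqr, map_zero, tsum_zero]
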